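/- Let $R$ be either (a) a commutative noetherian local ring with maximal ideal $m_R$, or (b) a connected noetherian graded algebra over a field $\mathbb F$ (so $R^i=0$ for $i<0$ and $R^0=\mathbb F$) which is commutative or graded-commutative, with $m_R=R^+$ the ideal of elements of positive degree. In case (b), "module" means non-negatively graded $R$-module, maps preserve degrees, and limits and products are formed in graded modules. A sequence $x_1,\dots,x_s\in m_R$ (of homogeneous elements in case (b)) is *regular* on an $R$-module $N$ if for every $i$ the element $x_i$ is not a zero divisor on $N/(x_1,\dots,x_{i-1})N$. The *depth* of $N$ is the maximal (supremal) length of a regular sequence on $N$; thus $\operatorname{depth} 0=\infty$. Let $\mathcal C$ be a small category, $\Phi$ a covariant functor from $\mathcal C$ to finitely generated $R$-modules, $M$ a finitely generated $R$-module, and $1_M\to\Phi$ a natural transformation from the constant functor with value $M$, inducing $\rho:M\to\lim_{\mathcal C}\Phi$. Put $L^{-1}=\ker\rho$, $L^0=\operatorname{coker}\rho$ and, for $i\ge 1$, $L^i=\lim^i_{\mathcal C}\Phi$, the $i$-th cohomology of the cochain complex $$C^n=\prod_{c_0\to c_1\to\cdots\to c_n}\Phi(c_n),\qquad \delta=\sum_{k=0}^{n+1}(-1)^k\delta^k:C^n\to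 C^{n+1},$$ where the product is over all strings of $n$ composable morphisms, $\delta^k(u)(c_0\to\cdots\to c_{n+1})=u(c_0\to\cdots\widehat{c_k}\cdots\to c_{n+1})$ for $k\le n$, and $\delta^{n+1}(u)(c_0\to\cdots\to c_{n+1})=\Phi(c_n\to c_{n+1})\,u(c_0\to\cdots\to c_n)$. Suppose that $\mathcal C$ is finite (finitely many objects and morphisms) or, more generally, that all the $R$-modules $L^i$, $i\ge -1$, are finitely generated. Let $r\ge 0$ be an integer. Suppose that $\operatorname{depth}\Phi(c)\ge r$ for every object $c$ of $\mathcal C$ and that, for each $i\ge -1$, either $L^i=0$ or $\operatorname{depth}L^i=0$. Then $$\operatorname{depth} M\ge r\quad\Longleftrightarrow\quad L^i=0\ \text{ for all } -1\le i\le r-2 .$$ -/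

import Mathlib

open CategoryTheory

universe u v w w' x

/-! ### Regular sequences and depth

The ring is not assumed to be commutative here, because graded-commutative rings are covered. -/

section Depth

variable {R : Type u} [Ring R]

/-- The submodule `(x₁, …, xₙ) N` of `N`, where `xs = [x₁, …, xₙ]`. -/
def seqSubmodule (xs : List R) (N : Type v) [AddCommGroup N] [Module R N] : Submodule R N :=
  Submodule.span R {y | ∃ x ∈ xs, ∃ n : N, y = x • n}

/-- The sequence `xs = [x₁, …, xₙ]` is regular on `N`: for all `i`, the element `xᵢ` is not a
zero divisor for the quotient `N / (x₁, …, xᵢ₋₁) N`, i.e. an element of `N` lies in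
`(x₁, …, xᵢ₋₁) N` as soon as its multiple by `xᵢ` does. -/
def IsRegularSeqOn (xs : List R) (N : Type v) [AddCommGroup N] [Module R N] : Prop :=
  ∀ (i : ℕ) (h : i < xs.length) (n : N),
    xs[i] • n ∈ seqSubmodule (xs.take i) N → n ∈ seqSubmodule (xs.take i) N

/-- The maximal length of a sequence of elements of `S` that is regular on `N`. In particular it
is `⊤` for `N = 0` as soon as `S` is non-empty. -/
noncomputable def depthIn (S : Set R) (N : Type v) [AddCommGroup N] [Module R N] : ℕ∞ :=
  ⨆ xs : {xs : List R // (∀ x ∈ xs, x ∈ S) ∧ IsRegularSeqOn xs N}, (xs.1.length : ℕ∞)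

/-- The elements of positive degree that are homogeneous, for a ring graded by `𝒜`. -/
def homogeneousPos {F : Type w} [Field F] [Algebra F R] (𝒜 : ℕ → Submodule F R) : Set R :=
  {x | ∃ i, 0 < i ∧ x ∈ 𝒜 i}

/-- Depth of a module over a connected graded algebra: the maximal length of a regular sequence
of homogeneous elements of the maximal ideal of elements of positive degree. -/
noncomputable def gradedDepth {F : Type w} [Field F] [Algebra F R] (𝒜 : ℕ → Submodule F R)
    (N : Type v) [AddCommGroup N] [Module R N] : ℕ∞ :=
  depthIn (homogeneousPos 𝒜) N

end Depth

/-- Depth of a module over a local ring: the maximal length of a regular sequence of elements of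
the maximal ideal. -/
noncomputable def localDepth (R : Type u) [CommRing R] [IsLocalRing R]
    (N : Type v) [AddCommGroup N] [Module R N] : ℕ∞ :=
  depthIn (IsLocalRing.maximalIdeal R : Set R) N

/-- Over a commutative ring, `IsRegularSeqOn` is Mathlib's notion of a weakly regular sequence. -/
theorem isRegularSeqOn_iff_isWeaklyRegular {R : Type u} [CommRing R] (xs : List R)
    (N : Type v) [AddCommGroup N] [Module R N] :
    IsRegularSeqOn xs N ↔ RingTheory.Sequence.IsWeaklyRegular N xs := by
  have key : ∀ ys : List R,
      (Ideal.ofList ys • ⊤ : Submodule R N) = seqSubmodule ys N := by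
    intro ys
    rw [Ideal.ofList, Submodule.span_smul_eq, Submodule.set_smul_eq_iSup, seqSubmodule]
    apply le_antisymm
    · refine iSup₂_le fun x hx => ?_
      rintro _ ⟨n, -, rfl⟩
      exact Submodule.subset_span ⟨x, hx, n, rfl⟩
    · rw [Submodule.span_le]
      rintro _ ⟨x, hx, n, rfl⟩
      exact Submodule.mem_iSup_of_mem x (Submodule.mem_iSup_of_mem hx ⟨n, trivial, rfl⟩)
  rw [RingTheory.Sequence.isWeaklyRegular_iff]
  refine forall₂_congr fun i h => ?_
  rw [isSMulRegular_iff_right_eq_zero_of_smul, key]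
  constructor
  · intro H y
    induction y using Submodule.Quotient.induction_on with
    | H n =>
      rw [← Submodule.Quotient.mk_smul, Submodule.Quotient.mk_eq_zero,
        Submodule.Quotient.mk_eq_zero]
      exact H n
  · intro H n hn
    rw [← Submodule.Quotient.mk_eq_zero] at hn ⊢
    exact H _ (by rwa [← Submodule.Quotient.mk_smul])

/-! ### The cochain complex computing derived limits, and the modules `Lⁱ` -/

section Limits

variable {R : Type u} [Ring R] {C : Type w} [Category.{w'} C] (Φ : C ⥤ ModuleCat.{v} R)

/-- The `n`-cochains: the product of the modules `Φ(cₙ)` over all strings `c₀ → c₁ → ⋯ → cₙ` of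
composable morphisms (`ComposableArrows C n`). -/
abbrev Cochain (n : ℕ) : Type (max v w w') :=
  ∀ σ : ComposableArrows C n, Φ.obj (σ.obj (Fin.last n))

/-- The string obtained from `c₀ → ⋯ → cₙ₊₁` by leaving out the object `c_k`. -/
abbrev omitObj {n : ℕ} (k : Fin (n + 2)) (σ : ComposableArrows C (n + 1)) :
    ComposableArrows C n where
  obj i := σ.obj (k.succAbove i)
  map f := σ.map (homOfLE ((Fin.strictMono_succAbove k).monotone (leOfHom f)))
  map_id _ := σ.map_id _
  map_comp _ _ := σ.map_comp _ _

/-- The morphism from the last object of the `k`-th face of `c₀ → ⋯ → cₙ₊₁` to `cₙ₊₁`. It is an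
identity for `k ≠ n + 1` and the last morphism `cₙ → cₙ₊₁` of the string for `k = n + 1`. -/
def omitObjLast {n : ℕ} (k : Fin (n + 2)) (σ : ComposableArrows C (n + 1)) :
    (omitObj k σ).obj (Fin.last n) ⟶ σ.obj (Fin.last (n + 1)) :=
  σ.map (homOfLE (Fin.le_last (k.succAbove (Fin.last n))))

/-- The differential `δ = ∑ₖ (-1)ᵏ δᵏ`, where `δᵏ u` takes the string `c₀ → ⋯ → cₙ₊₁` to
`u(c₀ → ⋯ ĉ_k ⋯ → cₙ₊₁)` for `k ≠ n + 1` and to `Φ(cₙ → cₙ₊₁) (u(c₀ → ⋯ → cₙ))` for `k = n + 1`. -/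
noncomputable def coboundary (n : ℕ) : Cochain Φ n →ₗ[R] Cochain Φ (n + 1) :=
  LinearMap.pi fun σ => ∑ k : Fin (n + 2),
    ((-1 : ℤ) ^ (k : ℕ)) • ((Φ.map (omitObjLast k σ)).hom ∘ₗ LinearMap.proj (omitObj k σ))

/-- The families `(x_c)` in the product of all `Φ(c)` that are compatible with all morphisms of
`C`: the limit of `Φ`. -/
def compatibleFamilies : Submodule R (∀ c, Φ.obj c) where
  carrier := {x | ∀ (c d : C) (f : c ⟶ d), Φ.map f (x c) = x d}
  add_mem' := by
    intro x y hx hy c d f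
    simp [hx c d f, hy c d f]
  zero_mem' := by
    intro c d f
    simp
  smul_mem' := by
    intro r x hx c d f
    simp [hx c d f]

variable {Φ}

/-- The linear map from `M` to the product of all `Φ(c)` whose components are those of a natural
transformation from the constant functor with value `M` to `Φ`. -/
def toProduct {M : ModuleCat.{v} R} (τ : (Functor.const C).obj M ⟶ Φ) : M →ₗ[R] ∀ c, Φ.obj c :=
  LinearMap.pi fun c => (τ.app c).hom

/-- The modules `Lⁱ` for `i ≥ -1`, where `P₀` and `P n` are the submodules of those families that
belong to the product of all `Φ(c)`, respectively to the `n`-cochains, as formed in the category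
under consideration (all families for modules, see `gradedProduct` for graded modules):
* `L⁻¹` is the kernel of `ρ : M → lim Φ` (lifted, so that all `Lⁱ` lie in one universe);
* `L⁰` is the cokernel of `ρ`;
* `Lⁱ`, for `i ≥ 1`, is the `i`-th cohomology of the cochain complex, i.e. the derived limit
  `limⁱ Φ`.
For `i < -1` the value is the zero module. -/
noncomputable def limitDefect {M : ModuleCat.{v} R} (τ : (Functor.const C).obj M ⟶ Φ)
    (P₀ : Submodule R (∀ c, Φ.obj c)) (P : ∀ n, Submodule R (Cochain Φ n)) :
    ℤ → ModuleCat.{max v w w'} R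
  | .negSucc 0 => ModuleCat.of R (ULift.{max w w'} (LinearMap.ker (toProduct τ)))
  | .negSucc (_ + 1) => ModuleCat.of R PUnit
  | .ofNat 0 => ModuleCat.of R
      (ULift.{w'} (↥(compatibleFamilies Φ ⊓ P₀) ⧸
        (LinearMap.range (toProduct τ)).submoduleOf (compatibleFamilies Φ ⊓ P₀)))
  | .ofNat (n + 1) => ModuleCat.of R
      (↥(LinearMap.ker (coboundary Φ (n + 1)) ⊓ P (n + 1)) ⧸
        ((P n).map (coboundary Φ n)).submoduleOf (LinearMap.ker (coboundary Φ (n + 1)) ⊓ P (n + 1)))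

/-- The modules `Lⁱ` in the category of modules. -/
noncomputable def moduleL {M : ModuleCat.{v} R} (τ : (Functor.const C).obj M ⟶ Φ) :
    ℤ → ModuleCat.{max v w w'} R :=
  limitDefect τ ⊤ (fun _ => ⊤)

/-- The product in the category of graded modules of the modules `Φ(f j)`, with gradings `𝒢`: the
submodule of the product generated by the families that are homogeneous of one common degree. It
is the whole product if the index type is finite. -/
def gradedProduct (𝒢 : ∀ c, ℕ → AddSubgroup (Φ.obj c)) {ι : Type*} (f : ι → C) :
    Submodule R (∀ j, Φ.obj (f j)) :=
  Submodule.span R {x | ∃ d, ∀ j, x j ∈ 𝒢 (f j) d}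

/-- The modules `Lⁱ` in the category of graded modules. -/
noncomputable def gradedL {M : ModuleCat.{v} R} (τ : (Functor.const C).obj M ⟶ Φ)
    (𝒢 : ∀ c, ℕ → AddSubgroup (Φ.obj c)) : ℤ → ModuleCat.{max v w w'} R :=
  limitDefect τ (gradedProduct 𝒢 id)
    (fun n => gradedProduct 𝒢 (fun σ : ComposableArrows C n => σ.obj (Fin.last n)))

end Limits

/-! ### Graded rings and modules -/

/-- `𝒩` is a (non-negative) grading of the module `N` over the graded ring `R`. -/
structure IsModuleGrading {F : Type w} {R : Type u} [Field F] [Ring R] [Algebra F R]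
    (𝒜 : ℕ → Submodule F R) {N : Type v} [AddCommGroup N] [Module R N]
    (𝒩 : ℕ → AddSubgroup N) : Prop where
  isInternal : DirectSum.IsInternal 𝒩
  smul_mem : ∀ (i j : ℕ) (a : R) (n : N), a ∈ 𝒜 i → n ∈ 𝒩 j → a • n ∈ 𝒩 (i + j)

/-- `R` is commutative or graded-commutative (the sign rule `a b = (-1)^{|a| |b|} b a` for
homogeneous elements). -/
def IsCommOrGradedComm {F : Type w} {R : Type u} [Field F] [Ring R] [Algebra F R]
    (𝒜 : ℕ → Submodule F R) : Prop :=
  (∀ a b : R, a * b = b * a) ∨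
    ∀ (i j : ℕ) (a b : R), a ∈ 𝒜 i → b ∈ 𝒜 j → a * b = (-1) ^ (i * j) * (b * a)

/-! Depth is translated into Koszul cohomology. For a suitable finite family `y` of central
elements, a finitely generated `N` has depth at least `r` exactly when the Koszul cohomology of `y`
with coefficients in `N` vanishes in all degrees below `r` (`le_depthIn_iff_koszulExactAt`). Unlike
depth, this vanishing is governed by long exact sequences and passes to products, also infinite or
graded ones (`KoszulExactAt.pi`, `koszulExactAt_gradedProduct`). Hence every cochain module `Cⁿ`
inherits it from the `Φ(c)`, whether or not `Cⁿ` is finitely generated.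

The rest is dimension shifting. Let `Zⁿ` be the cocycles, `Bⁿ` the coboundaries, with `B⁰` the image
of `M`. If the `Lⁱ` vanish in the stated range, then `M ≅ B⁰` and the sequences `0 → Bⁿ → Cⁿ → Bⁿ⁺¹
→ 0` carry vanishing back to `M` (`KoszulExactAt.of_exact_at`). Conversely, if the cohomology of `M`
vanishes below `r`, the same sequences push it forward. At each stage `H⁰(Zⁿ) = 0` and `H¹(Bⁿ) = 0`
give `H⁰(Lⁿ) = 0`; then `Lⁿ` has positive depth, so it is zero by the dichotomy assumed for the `Lⁱ`
(`KoszulExactAt.exact_at`).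

In the graded-commutative case outside characteristic 2, odd elements square to zero and are never
regular on a non-zero module, so only even elements matter. They are central, and `R` is finite over
its commutative noetherian even part (`IsCentralProjection`), where prime avoidance over associated
primes produces regular elements. -/

/-! ### Koszul cohomology -/

section Lift

variable {R κ : Type*} [Ring R] {A B D : Type*} [AddCommGroup A] [Module R A] [AddCommGroup B] [Module R B]
  [AddCommGroup D] [Module R D]

/-- A lift of a family along a surjection which is zero where the family is. -/
theorem exists_comp_eq_of_surjective {g : B →ₗ[R] D} (hg : Function.Surjective g)
    (u : κ → D) : ∃ u' : κ → B, g ∘ u' = u ∧ ∀ T, u T = 0 → u' T = 0 := by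
  classical
  choose s hs using hg
  refine ⟨fun T => if u T = 0 then 0 else s (u T), funext fun T => ?_, fun T hT => if_pos hT⟩
  by_cases hT : u T = 0 <;> simp [hT, hs]

/-- Cochain degrees are recorded by supports, so the clause on zeros keeps the preimage in the same
degree. -/
theorem exists_comp_eq_of_exact {f : A →ₗ[R] B} {g : B →ₗ[R] D} (hf : Function.Injective f)
    (hfg : Function.Exact f g) (u : κ → B) (hu : g ∘ u = 0) :
    ∃ a : κ → A, f ∘ a = u ∧ ∀ T, u T = 0 → a T = 0 := by
  choose a ha using fun T => (hfg (u T)).1 (congrFun hu T)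
  exact ⟨a, funext ha, fun T hT => hf (by rw [ha, hT, map_zero])⟩

end Lift

section Koszul

variable {ι : Type*} [LinearOrder ι]

/-- The sign of moving `j` to its place in the increasing enumeration of `T`. -/
def koszulSign (j : ι) (T : Finset ι) : ℤ := (-1) ^ (T.filter (· < j)).card

theorem koszulSign_mul_self (j : ι) (T : Finset ι) : koszulSign j T * koszulSign j T = 1 := by
  rw [koszulSign, ← mul_pow]; simp

theorem koszulSign_erase {k : ι} (j : ι) {T : Finset ι} (hk : k ∈ T) :
    koszulSign j (T.erase k) = if k < j then -koszulSign j T else koszulSign j T := by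
  unfold koszulSign
  split_ifs with h
  · have hk' : k ∈ T.filter (· < j) := Finset.mem_filter.2 ⟨hk, h⟩
    rw [Finset.filter_erase, ← Finset.card_erase_add_one hk', pow_succ]
    ring
  · rw [Finset.filter_erase, Finset.erase_eq_of_notMem]
    simp [h]

theorem koszulSign_erase_self {j : ι} {T : Finset ι} (hj : j ∈ T) :
    koszulSign j (T.erase j) = koszulSign j T := by
  simp [koszulSign_erase j hj]

/-- Removing the smaller of two elements first changes the position of the larger by one, and not
conversely. All anticommutation rules rest on this. -/
theorem koszulSign_mul_erase {j k : ι} {T : Finset ι} (hj : j ∈ T) (hk : k ∈ T) (h : j ≠ k) :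
    koszulSign j T * koszulSign k (T.erase j) = -(koszulSign k T * koszulSign j (T.erase k)) := by
  rw [koszulSign_erase _ hj, koszulSign_erase _ hk]
  rcases lt_or_gt_of_ne h with h | h
  · rw [if_pos h, if_neg h.not_gt]; ring
  · rw [if_neg h.not_gt, if_pos h]; ring

variable {N : Type*} [AddCommGroup N]

/-- Exterior multiplication by the `j`-th basis vector, on functions on subsets. -/
def wedge (j : ι) (u : Finset ι → N) : Finset ι → N := fun T =>
  if j ∈ T then koszulSign j T • u (T.erase j) else 0

/-- Contraction with the `j`-th dual basis vector, on functions on subsets. -/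
def contract (j : ι) (u : Finset ι → N) : Finset ι → N := fun T =>
  if j ∈ T then 0 else koszulSign j T • u (insert j T)

theorem wedge_wedge_self (j : ι) (u : Finset ι → N) : wedge j (wedge j u) = 0 := by
  funext T; simp [wedge]

theorem wedge_wedge {j k : ι} (h : j ≠ k) (u : Finset ι → N) :
    wedge j (wedge k u) = -wedge k (wedge j u) := by
  funext T
  by_cases hj : j ∈ T <;> by_cases hk : k ∈ T <;> simp [wedge, hj, hk, h, h.symm]
  rw [smul_smul, smul_smul, koszulSign_mul_erase hj hk h, neg_smul, Finset.erase_right_comm]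

/-- Together with `contract_wedge` these are the Clifford relations behind the null-homotopy
`koszulD_contract`. -/
theorem contract_wedge_self (j : ι) (u : Finset ι → N) :
    contract j (wedge j u) + wedge j (contract j u) = u := by
  funext T
  by_cases hj : j ∈ T
  · simp [wedge, contract, hj, smul_smul, koszulSign_erase_self hj, koszulSign_mul_self]
  · have := koszulSign_erase_self (Finset.mem_insert_self j T)
    rw [Finset.erase_insert hj] at this
    simp [wedge, contract, hj, smul_smul, ← this, koszulSign_mul_self]

theorem contract_wedge {j k : ι} (h : j ≠ k) (u : Finset ι → N) :
    contract j (wedge k u) + wedge k (contract j u) = 0 := by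
  funext T
  by_cases hj : j ∈ T <;> by_cases hk : k ∈ T <;> simp [wedge, contract, hj, hk, h, h.symm]
  have h1 := koszulSign_mul_erase (Finset.mem_insert_self j T) (Finset.mem_insert_of_mem hk) h
  have h2 := koszulSign_erase_self (Finset.mem_insert_self j T)
  have h3 := koszulSign_erase k (Finset.mem_insert_self j T)
  have h4 := koszulSign_erase j hk
  have h5 := koszulSign_erase j (Finset.mem_insert_of_mem (b := j) hk)
  rw [Finset.erase_insert hj] at h1 h2 h3
  rw [Finset.erase_insert_of_ne h, smul_smul, smul_smul, ← add_smul]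
  convert zero_smul ℤ _
  rw [h4, h3, h2]
  rcases lt_or_gt_of_ne h with h' | h'
  · rw [if_pos h', if_neg h'.not_gt]; ring
  · rw [if_neg h'.not_gt, if_pos h']; ring

variable {R : Type*} [Ring R] [Module R N]

theorem wedge_add (j : ι) (u v : Finset ι → N) : wedge j (u + v) = wedge j u + wedge j v := by
  funext T; by_cases hj : j ∈ T <;> simp [wedge, hj]

theorem wedge_smul (j : ι) (a : R) (u : Finset ι → N) : wedge j (a • u) = a • wedge j u := by
  funext T; by_cases hj : j ∈ T <;> simp [wedge, hj, smul_comm (koszulSign j T) a]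

theorem contract_smul (j : ι) (a : R) (u : Finset ι → N) :
    contract j (a • u) = a • contract j u := by
  funext T; by_cases hj : j ∈ T <;> simp [contract, hj, smul_comm (koszulSign j T) a]

theorem contract_add (j : ι) (u v : Finset ι → N) :
    contract j (u + v) = contract j u + contract j v := by
  funext T; by_cases hj : j ∈ T <;> simp [contract, hj]

/-- `wedge` as an additive map. -/
def wedgeHom (j : ι) : (Finset ι → N) →+ (Finset ι → N) := AddMonoidHom.mk' (wedge j) (wedge_add j)

/-- `contract` as an additive map. -/
def contractHom (j : ι) : (Finset ι → N) →+ (Finset ι → N) :=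
  AddMonoidHom.mk' (contract j) (contract_add j)

theorem wedge_sum (j : ι) {κ : Type*} (s : Finset κ) (u : κ → Finset ι → N) :
    wedge j (∑ k ∈ s, u k) = ∑ k ∈ s, wedge j (u k) :=
  map_sum (wedgeHom j) u s

theorem contract_sum (j : ι) {κ : Type*} (s : Finset κ) (u : κ → Finset ι → N) :
    contract j (∑ k ∈ s, u k) = ∑ k ∈ s, contract j (u k) :=
  map_sum (contractHom j) u s

theorem contract_supported {i : ℕ} {u : Finset ι → N} (hu : ∀ T, T.card ≠ i → u T = 0) (j : ι)
    (T : Finset ι) (hT : T.card + 1 ≠ i) : contract j u T = 0 := by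
  by_cases hj : j ∈ T
  · simp [contract, hj]
  · have : u (insert j T) = 0 := hu _ fun h => hT (by rw [← h, Finset.card_insert_of_notMem hj])
    simp [contract, hj, this]

variable [Fintype ι]

/-- The differential of the Koszul complex of the elements `y j` with coefficients in `N`. The
cochains of degree `i` are the functions supported on the subsets with `i` elements. -/
def koszulD (y : ι → R) : (Finset ι → N) →+ (Finset ι → N) :=
  AddMonoidHom.mk' (fun u => ∑ j, y j • wedge j u) fun u v => by
    simp [wedge_add, smul_add, Finset.sum_add_distrib]

theorem koszulD_apply (y : ι → R) (u : Finset ι → N) : koszulD y u = ∑ j, y j • wedge j u := rfl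

theorem koszulD_comp (y : ι → R) {N' : Type*} [AddCommGroup N'] [Module R N'] (f : N →ₗ[R] N')
    (u : Finset ι → N) : koszulD y (f ∘ u) = f ∘ koszulD y u := by
  funext T
  simp only [koszulD_apply, Finset.sum_apply, Pi.smul_apply, Function.comp_apply, map_sum,
    map_smul]
  refine Finset.sum_congr rfl fun j _ => ?_
  by_cases hj : j ∈ T <;> simp [wedge, hj]

theorem koszulD_koszulD {y : ι → R} (hy : ∀ j a, y j * a = a * y j) (u : Finset ι → N) :
    koszulD y (koszulD y u) = 0 := by
  simp only [koszulD_apply, wedge_sum, wedge_smul, Finset.smul_sum, smul_smul]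
  rw [← Finset.sum_product' (f := fun j k => (y j * y k) • wedge j (wedge k u))]
  -- The terms for `(j, k)` and `(k, j)` cancel by anticommutation; the diagonal terms are zero.
  refine Finset.sum_involution (fun p _ => p.swap) ?_ ?_ ?_ ?_
  · rintro ⟨j, k⟩ -
    by_cases h : j = k
    · simp [h, wedge_wedge_self]
    · simp [wedge_wedge h, hy j (y k)]
  · rintro ⟨j, k⟩ - hne h
    obtain rfl : k = j := congrArg Prod.fst h
    simp [wedge_wedge_self] at hne
  · simp
  · simp

/-- Multiplication by a left linear combination of the `y j` is null-homotopic. -/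
theorem koszulD_contract {y : ι → R} (hy : ∀ j a, y j * a = a * y j) (a : ι → R)
    (u : Finset ι → N) :
    koszulD y (∑ j, a j • contract j u) + ∑ j, a j • contract j (koszulD y u) =
      (∑ j, a j * y j) • u := by
  have key : ∀ j, koszulD y (a j • contract j u) + a j • contract j (koszulD y u) =
      (a j * y j) • u := by
    intro j
    simp only [koszulD_apply, contract_sum, contract_smul, Finset.smul_sum, wedge_smul, smul_smul]
    -- By the Clifford relations only `k = j` survives; centrality of the `y k` lets them move past
    -- `a j`.
    rw [← Finset.sum_add_distrib, Finset.sum_eq_single j]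
    · rw [hy, ← smul_add, add_comm, contract_wedge_self]
    · intro k _ hk
      rw [hy, ← smul_add, add_comm, contract_wedge hk.symm, smul_zero]
    · simp
  rw [map_sum, ← Finset.sum_add_distrib, Finset.sum_smul]
  exact Finset.sum_congr rfl fun j _ => key j

theorem koszulD_supported (y : ι → R) {i : ℕ} {u : Finset ι → N}
    (hu : ∀ T, T.card ≠ i → u T = 0) (T : Finset ι) (hT : T.card ≠ i + 1) :
    koszulD y u T = 0 := by
  rw [koszulD_apply, Finset.sum_apply]
  refine Finset.sum_eq_zero fun j _ => ?_
  by_cases hj : j ∈ T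
  · have : u (T.erase j) = 0 := hu _ fun h => hT (by rw [← h, Finset.card_erase_add_one hj])
    simp [wedge, hj, this]
  · simp [wedge, hj]

/-- The Koszul cohomology of the elements `y j` with coefficients in `N` vanishes in degree `i`. -/
def KoszulExactAt (y : ι → R) (N : Type*) [AddCommGroup N] [Module R N] (i : ℕ) : Prop :=
  ∀ u : Finset ι → N, (∀ T, T.card ≠ i → u T = 0) → koszulD y u = 0 →
    ∃ v : Finset ι → N, (∀ T, T.card + 1 ≠ i → v T = 0) ∧ koszulD y v = u

theorem koszulExactAt_of_subsingleton (y : ι → R) (i : ℕ) [Subsingleton N] :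
    KoszulExactAt y N i :=
  fun _ _ _ => ⟨0, fun _ _ => rfl, Subsingleton.elim _ _⟩

/-- A cochain of degree 0 is its value `n` at `∅`, and its differential takes the value `y j • n` at
`{j}`. There are no coboundaries, since the support condition forces `v = 0`. -/
theorem koszulExactAt_zero_iff (y : ι → R) :
    KoszulExactAt y N 0 ↔ ∀ n : N, (∀ j, y j • n = 0) → n = 0 := by
  constructor
  · intro h n hn
    obtain ⟨v, hv, hvu⟩ := h (fun T => if T = ∅ then n else 0)
      (fun T hT => if_neg fun h => hT (by simp [h])) (by
        funext T
        rw [koszulD_apply, Finset.sum_apply]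
        refine Finset.sum_eq_zero fun j _ => ?_
        by_cases hj : j ∈ T
        · by_cases hT : T.erase j = ∅ <;> simp [wedge, hj, hT, smul_comm _ (koszulSign j T), hn]
        · simp [wedge, hj])
    have : v = 0 := funext fun T => hv T (by simp)
    rw [this, map_zero] at hvu
    simpa using (congrFun hvu ∅).symm
  · intro h u hu hd
    have hu0 : u = 0 := by
      funext T
      by_cases hT : T.card = 0
      · rw [Finset.card_eq_zero] at hT
        subst hT
        refine h _ fun j => ?_
        have := congrFun hd {j}
        rw [koszulD_apply, Finset.sum_apply, Finset.sum_eq_single j] at this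
        · have h1 : ((-1 : ℤ) ^ 0 : ℤ) = 1 := rfl
          simpa [wedge, koszulSign, Finset.filter_singleton] using this
        · intro k _ hk
          simp [wedge, hk]
        · simp
      · exact hu T hT
    exact ⟨0, fun _ _ => rfl, by rw [hu0, map_zero]⟩

/-! ### Exact sequences and products in Koszul cohomology. -/

variable {A B D : Type*} [AddCommGroup A] [Module R A] [AddCommGroup B] [Module R B]
  [AddCommGroup D] [Module R D]

/-- The connecting homomorphism of a short exact sequence, in terms of cochains: a cochain of `A`
that becomes a coboundary in `B` is a coboundary if the cohomology of `D` vanishes one degree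
below. -/
theorem exists_koszulD_eq_of_exact {y : ι → R} {f : A →ₗ[R] B} {g : B →ₗ[R] D}
    (hf : Function.Injective f) (hg : Function.Surjective g) (hfg : Function.Exact f g) {i : ℕ}
    (hy : ∀ j a, y j * a = a * y j) {u : Finset ι → A} {v : Finset ι → B}
    (hv : ∀ T, T.card + 1 ≠ i → v T = 0) (hvu : koszulD y v = f ∘ u)
    (hD : ∀ k, k + 1 = i → KoszulExactAt y D k) :
    ∃ a : Finset ι → A, (∀ T, T.card + 1 ≠ i → a T = 0) ∧ koszulD y a = u := by
  have hgf : ∀ a, g (f a) = 0 := fun a => (hfg _).2 ⟨a, rfl⟩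
  rcases i with _ | k
  · have hv0 : v = 0 := funext fun T => hv T (by simp)
    rw [hv0, map_zero] at hvu
    refine ⟨0, fun _ _ => rfl, ?_⟩
    rw [map_zero]
    funext T
    exact hf ((map_zero f).trans (congrFun hvu T))
  -- The image of `v` in `D` is a cocycle, hence some `d w`; correcting `v` by the differential of a
  -- lift of `w` moves it into `A` without changing its differential.
  · obtain ⟨w, hw, hwv⟩ := hD k rfl (g ∘ v) (fun T hT => by simp [hv T (by omega)]) (by
      rw [koszulD_comp, hvu]; funext T; simp [hgf])
    obtain ⟨w', hw', hw'0⟩ := exists_comp_eq_of_surjective hg w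
    obtain ⟨a, ha, ha0⟩ := exists_comp_eq_of_exact hf hfg (v - koszulD y w') (by
      have : g ∘ (v - koszulD y w') = g ∘ v - g ∘ koszulD y w' := by funext T; simp
      rw [this, ← koszulD_comp, hw', hwv, sub_self])
    refine ⟨a, fun T hT => ha0 T ?_, ?_⟩
    · have hT' : T.card ≠ k := by omega
      rcases k with _ | k
      · have : w' = 0 := funext fun T => hw'0 T (hw T (by simp))
        simp [this, hv T hT]
      · rw [Pi.sub_apply, hv T hT, koszulD_supported y (i := k) _ T hT', sub_zero]
        exact fun T hT => hw'0 T (hw T (by omega))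
    · have h1 : f ∘ koszulD y a = f ∘ u := by
        rw [← koszulD_comp, ha, map_sub, koszulD_koszulD hy, sub_zero, hvu]
      funext T
      exact hf (congrFun h1 T)

/-- This is exactness of `Hⁱ⁻¹(D) → Hⁱ(A) → Hⁱ(B)`; for `i = 0` the condition on `D` is void. -/
theorem KoszulExactAt.left_of_exact {y : ι → R} {f : A →ₗ[R] B} {g : B →ₗ[R] D}
    (hf : Function.Injective f) (hg : Function.Surjective g) (hfg : Function.Exact f g) {i : ℕ}
    (hy : ∀ j a, y j * a = a * y j)
    (hB : KoszulExactAt y B i) (hD : ∀ k, k + 1 = i → KoszulExactAt y D k) :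
    KoszulExactAt y A i := by
  intro u hu hd
  obtain ⟨v, hv, hvu⟩ := hB (f ∘ u) (fun T hT => by simp [hu T hT]) (by
    rw [koszulD_comp, hd]; funext T; simp)
  exact exists_koszulD_eq_of_exact hf hg hfg hy hv hvu hD

/-- This is exactness of `Hⁱ(B) → Hⁱ(D) → Hⁱ⁺¹(A)`: a cocycle of `D` lifts to a cochain of `B`,
which is corrected by a cochain of `A` to a cocycle. -/
theorem KoszulExactAt.right_of_exact {y : ι → R} {f : A →ₗ[R] B} {g : B →ₗ[R] D}
    (hf : Function.Injective f) (hg : Function.Surjective g) (hfg : Function.Exact f g) {i : ℕ}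
    (hy : ∀ j a, y j * a = a * y j)
    (hB : KoszulExactAt y B i) (hA : KoszulExactAt y A (i + 1)) : KoszulExactAt y D i := by
  intro u hu hd
  obtain ⟨u', hu', hu'0⟩ := exists_comp_eq_of_surjective hg u
  have hs : ∀ T, T.card ≠ i → u' T = 0 := fun T hT => hu'0 T (hu T hT)
  have hgf : ∀ a, g (f a) = 0 := fun a => (hfg _).2 ⟨a, rfl⟩
  obtain ⟨a, ha, ha0⟩ := exists_comp_eq_of_exact hf hfg (koszulD y u') (by
    rw [← koszulD_comp, hu', hd])
  obtain ⟨a', ha', hda'⟩ := hA a (fun T hT => ha0 T (koszulD_supported y hs T hT)) (by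
    funext T
    apply hf
    rw [← Function.comp_apply (f := f), ← koszulD_comp, ha, koszulD_koszulD hy]
    simp)
  obtain ⟨v, hv, hdv⟩ := hB (u' - f ∘ a')
    (fun T hT => by simp [hs T hT, ha' T (by omega)]) (by
      rw [map_sub, koszulD_comp, hda', ha, sub_self])
  refine ⟨g ∘ v, fun T hT => by simp [hv T hT], ?_⟩
  rw [koszulD_comp, hdv, ← hu']
  funext T
  simp [hgf]

theorem KoszulExactAt.zero_of_injective {y : ι → R} {f : A →ₗ[R] B} (hf : Function.Injective f)
    (hB : KoszulExactAt y B 0) : KoszulExactAt y A 0 := by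
  rw [koszulExactAt_zero_iff] at hB ⊢
  intro n hn
  refine hf ((hB (f n) fun j => ?_).trans (map_zero f).symm)
  rw [← map_smul, hn, map_zero]

theorem KoszulExactAt.of_linearEquiv {y : ι → R} (e : A ≃ₗ[R] B) {i : ℕ}
    (hA : KoszulExactAt y A i) : KoszulExactAt y B i := by
  intro u hu hd
  obtain ⟨v, hv, hdv⟩ := hA (e.symm ∘ u) (fun T hT => by simp [hu T hT]) (by
    have := koszulD_comp y e.symm.toLinearMap u
    simp only [LinearEquiv.coe_coe] at this
    rw [this, hd]; funext T; simp)
  refine ⟨e ∘ v, fun T hT => by simp [hv T hT], ?_⟩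
  have := koszulD_comp y e.toLinearMap v
  simp only [LinearEquiv.coe_coe] at this
  rw [this, hdv]
  funext T; simp

/-- The Koszul cohomology of `N` vanishes in degrees up to `r` if that of `N / x N` vanishes in
degrees below `r`, for a regular element `x` in the left ideal generated by the `y j`. -/
theorem KoszulExactAt.of_regular {y : ι → R} {f : A →ₗ[R] A} {g : A →ₗ[R] D} {x : R}
    (hfx : ∀ a, f a = x • a)
    (hf : Function.Injective f) (hg : Function.Surjective g) (hfg : Function.Exact f g) {i : ℕ}
    (hy : ∀ j a, y j * a = a * y j) (hx : x ∈ Submodule.span R (Set.range y))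
    (hD : ∀ k, k + 1 = i → KoszulExactAt y D k) : KoszulExactAt y A i := by
  intro u hu hd
  obtain ⟨c, hc⟩ := (Submodule.mem_span_range_iff_exists_fun R).1 hx
  simp only [smul_eq_mul] at hc
  -- Since `x = ∑ c j * y j`, the null-homotopy applied to the cocycle `u` gives `d v = x • u`:
  -- multiplication by `x` is zero on cohomology.
  set v : Finset ι → A := ∑ j, c j • contract j u with hv_def
  have hv : ∀ T, T.card + 1 ≠ i → v T = 0 := fun T hT => by
    rw [hv_def, Finset.sum_apply]
    exact Finset.sum_eq_zero fun j _ => by simp [contract_supported hu j T hT]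
  have hvu : koszulD y v = f ∘ u := by
    have h0 : ∀ j, contract j (0 : Finset ι → A) = 0 := fun j => map_zero (contractHom j)
    have := koszulD_contract hy c u
    rw [hd] at this
    simp only [h0, smul_zero, Finset.sum_const_zero, add_zero, hc] at this
    rw [this]
    funext T
    simp [hfx]
  exact exists_koszulD_eq_of_exact hf hg hfg hy hv hvu hD

theorem koszulD_pi_apply (y : ι → R) {κ : Type*} {N : κ → Type*} [∀ c, AddCommGroup (N c)]
    [∀ c, Module R (N c)] (u : Finset ι → ∀ c, N c) (T : Finset ι) (c : κ) :
    koszulD y u T c = koszulD y (fun T => u T c) T :=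
  (congrFun (koszulD_comp y (LinearMap.proj (R := R) (φ := N) c) u) T).symm

theorem KoszulExactAt.pi {y : ι → R} {κ : Type*} {N : κ → Type*} [∀ c, AddCommGroup (N c)]
    [∀ c, Module R (N c)] {i : ℕ} (h : ∀ c, KoszulExactAt y (N c) i) :
    KoszulExactAt y (∀ c, N c) i := by
  intro u hu hd
  choose v hv hdv using fun c => h c (fun T => u T c) (fun T hT => by simp [hu T hT])
    (funext fun T => by rw [← koszulD_pi_apply, hd]; rfl)
  exact ⟨fun T c => v c T, fun T hT => funext fun c => hv c T hT,
    funext fun T => funext fun c => by rw [koszulD_pi_apply, hdv]⟩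

end Koszul

/-! ### Depth and Koszul cohomology -/

section DepthKoszul

variable {R : Type u} [Ring R]

theorem seqSubmodule_cons (x : R) (ys : List R) (N : Type v) [AddCommGroup N] [Module R N] :
    seqSubmodule (x :: ys) N = seqSubmodule [x] N ⊔ seqSubmodule ys N := by
  rw [seqSubmodule, seqSubmodule, seqSubmodule, ← Submodule.span_union]
  congr 1
  ext n
  simp

theorem map_seqSubmodule (ys : List R) {N N' : Type*} [AddCommGroup N] [Module R N]
    [AddCommGroup N'] [Module R N'] {f : N →ₗ[R] N'} (hf : Function.Surjective f) :
    (seqSubmodule ys N).map f = seqSubmodule ys N' := by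
  rw [seqSubmodule, seqSubmodule, Submodule.map_span]
  congr 1
  ext n
  constructor
  · rintro ⟨_, ⟨x, hx, n, rfl⟩, rfl⟩
    exact ⟨x, hx, f n, map_smul _ _ _⟩
  · rintro ⟨x, hx, n, rfl⟩
    obtain ⟨n, rfl⟩ := hf n
    exact ⟨_, ⟨x, hx, n, rfl⟩, map_smul _ _ _⟩

theorem mkQ_mem_seqSubmodule_iff (x : R) (ys : List R) {N : Type v} [AddCommGroup N] [Module R N]
    (n : N) :
    (seqSubmodule [x] N).mkQ n ∈ seqSubmodule ys (N ⧸ seqSubmodule [x] N) ↔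
      n ∈ seqSubmodule (x :: ys) N := by
  rw [← map_seqSubmodule ys (Submodule.mkQ_surjective _), ← Submodule.mem_comap,
    Submodule.comap_map_eq, Submodule.ker_mkQ, seqSubmodule_cons x ys,
    sup_comm]

theorem seqSubmodule_nil (N : Type v) [AddCommGroup N] [Module R N] :
    seqSubmodule ([] : List R) N = ⊥ := by
  simp [seqSubmodule]

/-- Submodules `(x, x₁, …, xᵢ) N` contain `x N` and correspond to `(x₁, …, xᵢ)(N / x N)`. This makes
induction on the length possible. -/
theorem isRegularSeqOn_cons_iff (x : R) (xs : List R) (N : Type v) [AddCommGroup N] [Module R N] :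
    IsRegularSeqOn (x :: xs) N ↔
      (∀ n : N, x • n = 0 → n = 0) ∧ IsRegularSeqOn xs (N ⧸ seqSubmodule [x] N) := by
  constructor
  · intro h
    refine ⟨fun n hn => ?_, fun i hi n => ?_⟩
    · have := h 0 (by simp) n
      simpa [seqSubmodule_nil, hn] using this
    · obtain ⟨n, rfl⟩ := Submodule.mkQ_surjective _ n
      have := h (i + 1) (by simpa using hi) n
      rw [← map_smul, mkQ_mem_seqSubmodule_iff, mkQ_mem_seqSubmodule_iff]
      simpa using this
  · rintro ⟨h0, h⟩ i hi n
    rcases i with _ | i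
    · simpa [seqSubmodule_nil] using h0 n
    · have := h i (by simpa using hi) ((seqSubmodule [x] N).mkQ n)
      rw [← map_smul, mkQ_mem_seqSubmodule_iff, mkQ_mem_seqSubmodule_iff] at this
      simpa using this

theorem IsRegularSeqOn.take {xs : List R} {N : Type v} [AddCommGroup N] [Module R N]
    (h : IsRegularSeqOn xs N) (k : ℕ) : IsRegularSeqOn (xs.take k) N := by
  intro i hi n
  rw [List.length_take, lt_min_iff] at hi
  have := h i hi.2 n
  rw [List.getElem_take, List.take_take, min_eq_left hi.1.le]
  exact this

/-- The supremum may be infinite, but initial segments of regular sequences are regular, so any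
finite lower bound is attained as an exact length. -/
theorem le_depthIn_iff_exists (S : Set R) (N : Type v) [AddCommGroup N] [Module R N] (r : ℕ) :
    (r : ℕ∞) ≤ depthIn S N ↔
      ∃ xs : List R, (∀ x ∈ xs, x ∈ S) ∧ IsRegularSeqOn xs N ∧ xs.length = r := by
  constructor
  · intro h
    obtain ⟨xs, hxs⟩ : ∃ xs : {xs : List R // (∀ x ∈ xs, x ∈ S) ∧ IsRegularSeqOn xs N},
        r ≤ xs.1.length := by
      by_contra! hlt
      rcases r with _ | r
      · exact absurd (hlt ⟨[], by simp, fun i hi => by simp at hi⟩) (Nat.not_lt_zero _)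
      · have : depthIn S N ≤ (r : ℕ∞) := iSup_le fun xs => by
          exact_mod_cast Nat.lt_succ_iff.1 (hlt xs)
        have := h.trans this
        norm_cast at this
        omega
    exact ⟨xs.1.take r, fun x hx => xs.2.1 x (List.mem_of_mem_take hx), xs.2.2.take r,
      by simpa using hxs⟩
  · rintro ⟨xs, hS, hreg, rfl⟩
    exact le_iSup (fun xs : {xs : List R // (∀ x ∈ xs, x ∈ S) ∧ IsRegularSeqOn xs N} =>
      (xs.1.length : ℕ∞)) ⟨xs, hS, hreg⟩

/-- Multiplication by a central element as a linear map. -/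
def centralSMul (x : R) (hx : ∀ a, x * a = a * x) (N : Type v) [AddCommGroup N] [Module R N] :
    N →ₗ[R] N where
  toFun n := x • n
  map_add' := smul_add x
  map_smul' a n := by simp [smul_smul, hx]

theorem exact_centralSMul_mkQ (x : R) (hx : ∀ a, x * a = a * x) (N : Type v) [AddCommGroup N]
    [Module R N] : Function.Exact (centralSMul x hx N) (seqSubmodule [x] N).mkQ := by
  rw [LinearMap.exact_iff, Submodule.ker_mkQ]
  apply le_antisymm
  · rw [seqSubmodule, Submodule.span_le]
    rintro _ ⟨z, hz, n, rfl⟩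
    rw [List.mem_singleton] at hz
    exact ⟨n, by rw [hz]; rfl⟩
  · rintro _ ⟨n, rfl⟩
    exact Submodule.subset_span ⟨x, by simp, n, rfl⟩

/-- Depth is detected by Koszul cohomology, provided that the elements of `S` that are regular on a
non-zero module lie in a subset `G` of central elements, and that a finitely generated module
without non-zero elements killed by `G` admits a regular element in `G`. -/
theorem le_depthIn_iff_koszulExactAt {S G : Set R} {ι : Type*} [LinearOrder ι] [Fintype ι]
    {y : ι → R} (hyG : ∀ j, y j ∈ G) (hspan : G ⊆ Submodule.span R (Set.range y)) (hGS : G ⊆ S)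
    (hGc : ∀ x ∈ G, ∀ a, x * a = a * x)
    (hreg : ∀ (N : Type v) [AddCommGroup N] [Module R N] [Nontrivial N], ∀ x ∈ S,
      (∀ n : N, x • n = 0 → n = 0) → x ∈ G)
    (hex : ∀ (N : Type v) [AddCommGroup N] [Module R N] [Module.Finite R N],
      (∀ n : N, (∀ x ∈ G, x • n = 0) → n = 0) → ∃ x ∈ G, ∀ n : N, x • n = 0 → n = 0)
    (r : ℕ) (N : Type v) [AddCommGroup N] [Module R N] [Module.Finite R N] :
    (r : ℕ∞) ≤ depthIn S N ↔ ∀ i < r, KoszulExactAt y N i := by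
  have hy : ∀ j a, y j * a = a * y j := fun j => hGc _ (hyG j)
  rw [le_depthIn_iff_exists]
  induction r generalizing N with
  | zero => exact ⟨fun _ _ h => absurd h (Nat.not_lt_zero _),
      fun _ => ⟨[], by simp, fun i hi => by simp at hi, rfl⟩⟩
  | succ r ih =>
    constructor
    · rintro ⟨_ | ⟨x, xs⟩, hS, hx, hlen⟩ i hi
      · simp at hlen
      rw [isRegularSeqOn_cons_iff] at hx
      -- On the zero module every element is regular, so `x` need not lie in `G`; there the
      -- cohomology vanishes trivially.
      rcases subsingleton_or_nontrivial N with _ | _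
      · exact koszulExactAt_of_subsingleton y i
      have hxG := hreg N x (hS x (by simp)) hx.1
      have := (ih (N ⧸ seqSubmodule [x] N)).1
        ⟨xs, fun z hz => hS z (by simp [hz]), hx.2, by simpa using hlen⟩
      exact KoszulExactAt.of_regular (f := centralSMul x (hGc x hxG) N) (fun _ => rfl)
        ((injective_iff_map_eq_zero _).2 hx.1) (Submodule.mkQ_surjective _)
        (exact_centralSMul_mkQ x _ N) hy (hspan hxG) fun k hk => this k (by omega)
    · intro h
      -- Vanishing in degree 0 says that no non-zero element is killed by all `y j`, hence none by
      -- `G`. Dividing by the resulting regular `x` costs one degree of vanishing.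
      obtain ⟨x, hxG, hx⟩ := hex N fun n hn =>
        (koszulExactAt_zero_iff y).1 (h 0 (by omega)) n fun j => hn _ (hyG j)
      obtain ⟨xs, hS, hxs, hlen⟩ := (ih (N ⧸ seqSubmodule [x] N)).2 fun i hi =>
        KoszulExactAt.right_of_exact (f := centralSMul x (hGc x hxG) N)
        ((injective_iff_map_eq_zero _).2 hx) (Submodule.mkQ_surjective _)
        (exact_centralSMul_mkQ x _ N) hy (h i (by omega)) (h (i + 1) (by omega))
      refine ⟨x :: xs, ?_, (isRegularSeqOn_cons_iff x xs N).2 ⟨hx, hxs⟩, by simp [hlen]⟩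
      simpa using ⟨hGS hxG, hS⟩

end DepthKoszul

/-! ### Vanishing of the cohomology of a complex of modules -/

section Complex

variable {R : Type u} [Ring R] {ι : Type*} [LinearOrder ι] [Fintype ι] {y : ι → R}

/-- Induction on `r` along the shifted complex: `B` is the kernel of `P 0 → d(P 0)`, and `d(P 0)`
plays the role of `B` one step later, with `r` lowered by one. For `r = 1` the inclusion `B ≤ P 0`
suffices. -/
theorem KoszulExactAt.of_exact_at (hy : ∀ j a, y j * a = a * y j) {r : ℕ} {X : ℕ → Type v}
    [∀ n, AddCommGroup (X n)] [∀ n, Module R (X n)] (d : ∀ n, X n →ₗ[R] X (n + 1))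
    (P : ∀ n, Submodule R (X n)) (hdP : ∀ n, (P n).map (d n) ≤ P (n + 1))
    (hdd : ∀ n u, d (n + 1) (d n u) = 0)
    (hP : ∀ n, ∀ i < r, KoszulExactAt y (P n) i) (B : Submodule R (X 0))
    (hB : B ≤ LinearMap.ker (d 0) ⊓ P 0)
    (h0 : 1 < r → LinearMap.ker (d 0) ⊓ P 0 ≤ B)
    (h : ∀ n, n + 2 < r → LinearMap.ker (d (n + 1)) ⊓ P (n + 1) ≤ (P n).map (d n)) :
    ∀ i < r, KoszulExactAt y B i := by
  induction r generalizing X with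
  | zero => simp
  | succ r ih =>
    intro i hi
    have hBP : B ≤ P 0 := fun b hb => (hB hb).2
    rcases r with _ | r
    · obtain rfl : i = 0 := by omega
      exact (hP 0 0 hi).zero_of_injective (f := Submodule.inclusion hBP)
        (Submodule.inclusion_injective hBP)
    · have hB' := ih (X := fun n => X (n + 1)) (fun n => d (n + 1)) (fun n => P (n + 1))
        (fun n => hdP (n + 1)) (fun n => hdd (n + 1)) (fun n i hi => hP (n + 1) i (by omega))
        ((P 0).map (d 0))
        (le_inf (by rintro _ ⟨b, -, rfl⟩; exact hdd 0 b) (hdP 0))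
        (fun hr => h 0 (by omega)) (fun n hn => h (n + 1) (by omega))
      refine KoszulExactAt.left_of_exact (f := Submodule.inclusion hBP)
        (g := (d 0).submoduleMap (P 0)) (Submodule.inclusion_injective hBP)
        (LinearMap.submoduleMap_surjective _ _) ?_ hy (hP 0 i hi) fun k hk => hB' k (by omega)
      rintro ⟨b, hb⟩
      rw [Subtype.ext_iff, Set.mem_range]
      constructor
      · intro hb0
        exact ⟨⟨b, h0 (by omega) ⟨hb0, hb⟩⟩, rfl⟩
      · rintro ⟨b', hb'⟩
        obtain rfl : (b' : X 0) = b := congrArg Subtype.val hb'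
        exact (hB b'.2).1

/-- The cohomology of `B` vanishes in degree 1 and that of the cocycles in degree 0, so the quotient
has no `H⁰` and `h0` kills it. Then `d(P 0) ≅ P 0 / B` inherits vanishing below `r - 1`, and the
induction continues with the shifted complex. -/
theorem KoszulExactAt.exact_at (hy : ∀ j a, y j * a = a * y j) {r : ℕ} {X : ℕ → Type v}
    [∀ n, AddCommGroup (X n)] [∀ n, Module R (X n)] (d : ∀ n, X n →ₗ[R] X (n + 1))
    (P : ∀ n, Submodule R (X n)) (hdP : ∀ n, (P n).map (d n) ≤ P (n + 1))
    (hdd : ∀ n u, d (n + 1) (d n u) = 0)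
    (hP : ∀ n, ∀ i < r, KoszulExactAt y (P n) i) (B : Submodule R (X 0))
    (hB : B ≤ LinearMap.ker (d 0) ⊓ P 0) (hBy : ∀ i < r, KoszulExactAt y B i)
    (h0 : KoszulExactAt y
        (↥(LinearMap.ker (d 0) ⊓ P 0) ⧸ B.submoduleOf (LinearMap.ker (d 0) ⊓ P 0)) 0 →
      LinearMap.ker (d 0) ⊓ P 0 ≤ B)
    (h : ∀ n, KoszulExactAt y (↥(LinearMap.ker (d (n + 1)) ⊓ P (n + 1)) ⧸
        ((P n).map (d n)).submoduleOf (LinearMap.ker (d (n + 1)) ⊓ P (n + 1))) 0 →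
      LinearMap.ker (d (n + 1)) ⊓ P (n + 1) ≤ (P n).map (d n)) :
    (1 < r → LinearMap.ker (d 0) ⊓ P 0 ≤ B) ∧
      ∀ n, n + 2 < r → LinearMap.ker (d (n + 1)) ⊓ P (n + 1) ≤ (P n).map (d n) := by
  induction r generalizing X with
  | zero => simp
  | succ r ih =>
    have hBP : B ≤ P 0 := fun b hb => (hB hb).2
    have hle : 1 < r + 1 → LinearMap.ker (d 0) ⊓ P 0 ≤ B := by
      intro hr
      refine h0 (KoszulExactAt.right_of_exact (f := Submodule.inclusion hB)
        (Submodule.inclusion_injective hB) (Submodule.mkQ_surjective _) ?_ hy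
        ((hP 0 0 (by omega)).zero_of_injective (f := Submodule.inclusion inf_le_right)
          (Submodule.inclusion_injective _)) (hBy 1 hr))
      rw [LinearMap.exact_iff, Submodule.ker_mkQ, Submodule.range_inclusion]
      rfl
    refine ⟨hle, fun n hn => ?_⟩
    have := ih (X := fun n => X (n + 1)) (fun n => d (n + 1)) (fun n => P (n + 1))
      (fun n => hdP (n + 1)) (fun n => hdd (n + 1)) (fun n i hi => hP (n + 1) i (by omega))
      ((P 0).map (d 0))
      (le_inf (by rintro _ ⟨b, -, rfl⟩; exact hdd 0 b) (hdP 0)) ?_ (h 0) (fun n => h (n + 1))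
    · rcases n with _ | n
      · exact this.1 (by omega)
      · exact this.2 n (by omega)
    · intro i hi
      refine KoszulExactAt.right_of_exact (f := Submodule.inclusion hBP)
        (g := (d 0).submoduleMap (P 0)) (Submodule.inclusion_injective hBP)
        (LinearMap.submoduleMap_surjective _ _) ?_ hy (hP 0 i (by omega)) (hBy _ (by omega))
      rintro ⟨b, hb⟩
      rw [Subtype.ext_iff, Set.mem_range]
      constructor
      · intro hb0
        exact ⟨⟨b, hle (by omega) ⟨hb0, hb⟩⟩, rfl⟩
      · rintro ⟨b', hb'⟩
        obtain rfl : (b' : X 0) = b := congrArg Subtype.val hb'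
        exact (hB b'.2).1

end Complex

/-! ### The coboundary squares to zero -/

section Coboundary

variable {R : Type u} [Ring R] {C : Type w} [Category.{w'} C] {Φ : C ⥤ ModuleCat.{v} R}

/-- The restriction of a string of morphisms along a monotone map. -/
abbrev restrictArrows {m n : ℕ} (α : Fin (m + 1) →o Fin (n + 1)) (σ : ComposableArrows C n) :
    ComposableArrows C m where
  obj i := σ.obj (α i)
  map f := σ.map (homOfLE (α.monotone (leOfHom f)))
  map_id _ := σ.map_id _
  map_comp _ _ := σ.map_comp _ _

/-- The value of the cochain `u` at a restriction of `σ`, pushed forward to the last object. -/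
def pushedValue {m n : ℕ} (u : Cochain Φ m) (σ : ComposableArrows C n)
    (α : Fin (m + 1) →o Fin (n + 1)) : Φ.obj (σ.obj (Fin.last n)) :=
  (Φ.map (σ.map (homOfLE (Fin.le_last (α (Fin.last m)))))).hom (u (restrictArrows α σ))

theorem coboundary_apply {n : ℕ} (u : Cochain Φ n) (σ : ComposableArrows C (n + 1)) :
    coboundary Φ n u σ = ∑ k : Fin (n + 2),
      ((-1 : ℤ) ^ (k : ℕ)) • (Φ.map (omitObjLast k σ)).hom (u (omitObj k σ)) := by
  simp [coboundary]

/-- An iterated face enters only through the composite order map, and all its values lie in the one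
module at the last object of `σ`. -/
theorem map_pushedValue {m n : ℕ} (u : Cochain Φ m) (σ : ComposableArrows C (n + 1))
    (k : Fin (n + 2)) (α : Fin (m + 1) →o Fin (n + 1)) :
    (Φ.map (omitObjLast k σ)).hom (pushedValue u (omitObj k σ) α) =
      pushedValue u σ ((Fin.succAboveOrderEmb k).toOrderHom.comp α) := by
  unfold pushedValue omitObjLast
  rw [← ModuleCat.comp_apply, ← Φ.map_comp, ← σ.map_comp]
  rfl

theorem coboundary_coboundary (n : ℕ) (u : Cochain Φ n) :
    coboundary Φ (n + 1) (coboundary Φ n u) = 0 := by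
  funext σ
  have key : coboundary Φ (n + 1) (coboundary Φ n u) σ =
      ∑ k : Fin (n + 3), ∑ l : Fin (n + 2), ((-1 : ℤ) ^ ((k : ℕ) + l)) • pushedValue u σ
        ((Fin.succAboveOrderEmb k).toOrderHom.comp (Fin.succAboveOrderEmb l).toOrderHom) := by
    rw [coboundary_apply]
    refine Finset.sum_congr rfl fun k _ => ?_
    rw [coboundary_apply, map_sum, Finset.smul_sum]
    refine Finset.sum_congr rfl fun l _ => ?_
    rw [map_zsmul, smul_smul, ← pow_add, ← map_pushedValue]
    rfl
  rw [key, ← Finset.sum_product']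
  -- The involution omits the same two objects in the opposite order: the composite order map is
  -- unchanged and the sign flips.
  refine Finset.sum_involution (fun p _ => (p.1.succAbove p.2, p.2.predAbove p.1)) ?_ ?_ ?_ ?_
  · rintro ⟨k, l⟩ -
    have : (Fin.succAboveOrderEmb (k.succAbove l)).toOrderHom.comp
        (Fin.succAboveOrderEmb (l.predAbove k)).toOrderHom =
        (Fin.succAboveOrderEmb k).toOrderHom.comp (Fin.succAboveOrderEmb l).toOrderHom := by
      ext i : 2
      exact Fin.succAbove_succAbove_succAbove_predAbove k l i
    rw [this, Fin.neg_one_pow_succAbove_add_predAbove, neg_smul, add_neg_cancel]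
  · rintro ⟨k, l⟩ - - h
    exact Fin.succAbove_ne k l (congrArg Prod.fst h)
  · simp
  · rintro ⟨k, l⟩ -
    exact Prod.ext (Fin.succAbove_succAbove_predAbove k l) (Fin.predAbove_predAbove_succAbove k l)

variable (Φ) in
/-- A `0`-cochain is a family of elements of the `Φ(c)`. -/
def familyEquiv : (∀ c, Φ.obj c) ≃ₗ[R] Cochain Φ 0 where
  toFun u σ := u (σ.obj 0)
  map_add' _ _ := rfl
  map_smul' _ _ := rfl
  invFun u c := u (ComposableArrows.mk₀ c)
  left_inv _ := rfl
  right_inv u := by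
    funext σ
    obtain ⟨c, rfl⟩ := σ.mk₀_surjective
    rfl

theorem coboundary_familyEquiv (u : ∀ c, Φ.obj c) (σ : ComposableArrows C 1) :
    coboundary Φ 0 (familyEquiv Φ u) σ =
      u (σ.obj 1) - (Φ.map (σ.map (homOfLE (Fin.zero_le 1)))).hom (u (σ.obj 0)) := by
  rw [coboundary_apply, Fin.sum_univ_two, sub_eq_add_neg]
  have h0 : (Φ.map (omitObjLast 0 σ)).hom (familyEquiv Φ u (omitObj 0 σ)) = u (σ.obj 1) := by
    have : Φ.map (omitObjLast 0 σ) = 𝟙 (Φ.obj (σ.obj 1)) :=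
      (congrArg Φ.map (σ.map_id 1)).trans (Φ.map_id _)
    exact congrArg (fun f => f.hom (u (σ.obj 1))) this
  have h1 : (Φ.map (omitObjLast 1 σ)).hom (familyEquiv Φ u (omitObj 1 σ)) =
      (Φ.map (σ.map (homOfLE (Fin.zero_le 1)))).hom (u (σ.obj 0)) := rfl
  rw [h0, h1]
  simp

/-- On an arrow `f : c ⟶ d` the coboundary of a family `x` is `x d - Φ(f)(x c)`. -/
theorem map_compatibleFamilies :
    (compatibleFamilies Φ).map (familyEquiv Φ).toLinearMap = LinearMap.ker (coboundary Φ 0) := by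
  ext u
  constructor
  · rintro ⟨x, hx, rfl⟩
    funext σ
    exact (coboundary_familyEquiv x σ).trans (sub_eq_zero.2 (hx _ _ _).symm)
  · intro hu
    obtain ⟨x, rfl⟩ := (familyEquiv Φ).surjective u
    refine ⟨x, fun c d f => ?_, rfl⟩
    have := congrFun hu (ComposableArrows.mk₁ f)
    rw [coboundary_familyEquiv] at this
    exact (sub_eq_zero.1 this).symm

end Coboundary

/-! ### Vanishing of the modules `Lⁱ` -/

section LimitDefect

variable {R : Type u} [Ring R]

theorem subsingleton_quotient_submoduleOf_iff {N : Type*} [AddCommGroup N] [Module R N]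
    (V W : Submodule R N) : Subsingleton (V ⧸ W.submoduleOf V) ↔ V ≤ W := by
  rw [Submodule.Quotient.subsingleton_iff, Submodule.submoduleOf,
    Submodule.comap_subtype_eq_top]

variable {ι : Type*} [LinearOrder ι] [Fintype ι] {y : ι → R}

/-- A form in elements of `N`, which lets the quotient of families defining `L⁰` be compared with
the quotient of 0-cochains without an isomorphism between them. -/
theorem koszulExactAt_zero_quotient_iff {N : Type*} [AddCommGroup N] [Module R N]
    (V W : Submodule R N) : KoszulExactAt y (V ⧸ W.submoduleOf V) 0 ↔
      ∀ n ∈ V, (∀ j, y j • n ∈ W) → n ∈ W := by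
  have key : ∀ n : V, (W.submoduleOf V).mkQ n = 0 ↔ (n : N) ∈ W := fun n =>
    (Submodule.Quotient.mk_eq_zero _).trans Iff.rfl
  rw [koszulExactAt_zero_iff, (Submodule.mkQ_surjective _).forall]
  simp only [← map_smul, key]
  exact ⟨fun h n hn => h ⟨n, hn⟩, fun h n => h n n.2⟩

variable {C : Type w} [Category.{w'} C] {Φ : C ⥤ ModuleCat.{v} R} {M : ModuleCat.{v} R}

theorem range_toProduct_le (τ : (Functor.const C).obj M ⟶ Φ) :
    LinearMap.range (toProduct τ) ≤ compatibleFamilies Φ := by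
  rintro _ ⟨m, rfl⟩ c d f
  have := τ.naturality f
  exact (congrArg (fun g => g.hom m) this).symm

/-- The depth of `M`, expressed by Koszul cohomology, is controlled by the vanishing of the modules
`Lⁱ`. -/
theorem koszulExactAt_iff_limitDefect (hy : ∀ j a, y j * a = a * y j)
    (τ : (Functor.const C).obj M ⟶ Φ) (P₀ : Submodule R (∀ c, Φ.obj c))
    (P : ∀ n, Submodule R (Cochain Φ n)) (hτ : LinearMap.range (toProduct τ) ≤ P₀)
    (hP₀ : P₀.map (familyEquiv Φ).toLinearMap = P 0)
    (hδ : ∀ n, (P n).map (coboundary Φ n) ≤ P (n + 1)) {r : ℕ}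
    (hP : ∀ n, ∀ i < r, KoszulExactAt y (P n) i)
    (hL : ∀ i : ℤ, -1 ≤ i → KoszulExactAt y (limitDefect τ P₀ P i) 0 →
      Subsingleton (limitDefect τ P₀ P i)) :
    (∀ i < r, KoszulExactAt y M i) ↔
      ∀ i : ℤ, -1 ≤ i → i ≤ (r : ℤ) - 2 → Subsingleton (limitDefect τ P₀ P i) := by
  rcases Nat.eq_zero_or_pos r with rfl | hr
  · exact ⟨fun _ i h1 h2 => by push_cast at h2; omega, fun _ i hi => absurd hi (Nat.not_lt_zero i)⟩
  set e := (familyEquiv Φ).toLinearMap with he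
  set B := (LinearMap.range (toProduct τ)).map e with hB_def
  have hinj : Function.Injective e := (familyEquiv Φ).injective
  have hker : (compatibleFamilies Φ ⊓ P₀).map e = LinearMap.ker (coboundary Φ 0) ⊓ P 0 := by
    rw [Submodule.map_inf _ hinj, map_compatibleFamilies, hP₀]
  have hB : B ≤ LinearMap.ker (coboundary Φ 0) ⊓ P 0 := by
    rw [← hker]
    exact Submodule.map_mono (le_inf (range_toProduct_le τ) hτ)
  have hneg : Subsingleton (limitDefect τ P₀ P (-1)) ↔ LinearMap.ker (toProduct τ) = ⊥ :=
    (Equiv.ulift.subsingleton_congr).trans Submodule.subsingleton_iff_eq_bot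
  have hzero : Subsingleton (limitDefect τ P₀ P 0) ↔
      LinearMap.ker (coboundary Φ 0) ⊓ P 0 ≤ B := by
    rw [← hker, hB_def, Submodule.map_le_map_iff_of_injective hinj,
      ← subsingleton_quotient_submoduleOf_iff]
    exact Equiv.ulift.subsingleton_congr
  have hsucc : ∀ n : ℕ, Subsingleton (limitDefect τ P₀ P ((n : ℤ) + 1)) ↔
      LinearMap.ker (coboundary Φ (n + 1)) ⊓ P (n + 1) ≤ (P n).map (coboundary Φ n) :=
    fun n => subsingleton_quotient_submoduleOf_iff _ _
  -- Once `L⁻¹ = 0`, the module `M` may be replaced by its image `B` in the 0-cochains.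
  have hequiv : LinearMap.ker (toProduct τ) = ⊥ → ∀ i,
      KoszulExactAt y M i ↔ KoszulExactAt y B i := by
    intro h i
    have e' := (LinearEquiv.ofInjective (toProduct τ) (LinearMap.ker_eq_bot.1 h)).trans
      (Submodule.equivMapOfInjective e hinj _)
    exact ⟨.of_linearEquiv e', .of_linearEquiv e'.symm⟩
  constructor
  · intro hM
    have hk : LinearMap.ker (toProduct τ) = ⊥ := by
      rw [← hneg]
      -- The kernel is a submodule of `M`, whose cohomology vanishes in degree 0 because `r > 0`.
      refine hL (-1) le_rfl (KoszulExactAt.of_linearEquiv ULift.moduleEquiv.symm ?_)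
      exact (hM 0 hr).zero_of_injective (f := (LinearMap.ker (toProduct τ)).subtype)
        Subtype.val_injective
    have main := KoszulExactAt.exact_at hy (coboundary Φ) P hδ coboundary_coboundary hP B hB
      (fun i hi => (hequiv hk i).1 (hM i hi)) (fun h => by
        rw [← hzero]
        refine hL 0 (by omega) (KoszulExactAt.of_linearEquiv ULift.moduleEquiv.symm ?_)
        rw [koszulExactAt_zero_quotient_iff] at h ⊢
        intro n hn hny
        obtain ⟨n', hn', h'⟩ := h (e n) (hker ▸ Submodule.mem_map_of_mem hn) fun j => by
          rw [← map_smul]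
          exact Submodule.mem_map_of_mem (hny j)
        rwa [← hinj h'])
      (fun n h => (hsucc n).1 (hL _ (by omega) h))
    intro i h1 h2
    obtain ⟨k, rfl⟩ : ∃ k : ℕ, i = (k : ℤ) - 1 := ⟨(i + 1).toNat, by omega⟩
    rcases k with _ | _ | k
    · exact hneg.2 hk
    · exact hzero.2 (main.1 (by omega))
    · have := (hsucc k).2 (main.2 k (by omega))
      convert this using 3
      push_cast
      ring
  · intro h
    have hk := hneg.1 (h (-1) le_rfl (by omega))
    intro i hi
    rw [hequiv hk]
    exact KoszulExactAt.of_exact_at hy (coboundary Φ) P hδ coboundary_coboundary hP B hB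
      (fun hr => hzero.1 (h 0 (by omega) (by omega)))
      (fun n hn => (hsucc n).1 (h _ (by omega) (by omega))) i hi

/-- If `C` is finite, then all the modules `Lⁱ` are finitely generated. -/
theorem finite_limitDefect [IsNoetherianRing R] [Finite C] [∀ c d : C, Finite (c ⟶ d)]
    [∀ c, Module.Finite R (Φ.obj c)] [Module.Finite R M] (τ : (Functor.const C).obj M ⟶ Φ)
    (P₀ : Submodule R (∀ c, Φ.obj c)) (P : ∀ n, Submodule R (Cochain Φ n)) (i : ℤ) :
    Module.Finite R (limitDefect τ P₀ P i) := by
  -- Finitely many strings make each cochain module a finite product, and over a noetherian ring its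
  -- subquotients are finitely generated.
  have hfin : ∀ n, Finite (ComposableArrows C n) := by
    intro n
    refine Finite.of_injective
      (β := Σ o : Fin (n + 1) → C, ∀ i j : Fin (n + 1), (i ≤ j) → (o i ⟶ o j))
      (fun σ => ⟨σ.obj, fun i j h => σ.map (homOfLE h)⟩) ?_
    rintro ⟨o, m, _, _⟩ ⟨o', m', _, _⟩ h
    obtain rfl : o = o' := congrArg Sigma.fst h
    have hm := eq_of_heq (Sigma.mk.inj h).2
    have : @m = @m' := by
      funext i j f
      exact congrFun (congrFun (congrFun hm i) j) (leOfHom f)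
    subst this
    rfl
  match i with
  | .negSucc 0 => exact Module.Finite.equiv (ULift.moduleEquiv (R := R)).symm
  | .negSucc (_ + 1) => exact (inferInstance : Module.Finite R PUnit.{max v w w' + 1})
  | .ofNat 0 =>
    exact Module.Finite.equiv (ULift.moduleEquiv (R := R)
      (M := ↥(compatibleFamilies Φ ⊓ P₀) ⧸
        (LinearMap.range (toProduct τ)).submoduleOf (compatibleFamilies Φ ⊓ P₀))).symm
  | .ofNat (n + 1) =>
    exact (inferInstance : Module.Finite R
      (↥(LinearMap.ker (coboundary Φ (n + 1)) ⊓ P (n + 1)) ⧸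
        ((P n).map (coboundary Φ n)).submoduleOf _))

end LimitDefect

/-! ### Homogeneous prime avoidance and regular elements -/

section Avoidance

variable {A : Type*} [CommRing A] {𝒵 : ℕ → Set A}

/-- Only positive exponents occur because `1 ∈ 𝒵 0` is not assumed; it fails when every `𝒵 i` is a
maximal ideal. -/
theorem pow_mem_of_mul_mem (hmul : ∀ i j, ∀ x ∈ 𝒵 i, ∀ y ∈ 𝒵 j, x * y ∈ 𝒵 (i + j)) {i : ℕ} {x : A}
    (hx : x ∈ 𝒵 i) (k : ℕ) : x ^ (k + 1) ∈ 𝒵 ((k + 1) * i) := by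
  induction k with
  | zero => simpa using hx
  | succ k ih =>
    rw [pow_succ, add_mul _ 1 i, one_mul]
    exact hmul _ _ _ ih _ hx

/-- Prime avoidance for homogeneous elements of positive degree. -/
theorem exists_homogeneous_notMem (hadd : ∀ i, ∀ x ∈ 𝒵 i, ∀ y ∈ 𝒵 i, x + y ∈ 𝒵 i)
    (hmul : ∀ i j, ∀ x ∈ 𝒵 i, ∀ y ∈ 𝒵 j, x * y ∈ 𝒵 (i + j)) (hne : ∃ i, 0 < i ∧ (𝒵 i).Nonempty)
    (T : Finset (Ideal A)) (hT : ∀ P ∈ T, P.IsPrime ∧ ∃ i, 0 < i ∧ ∃ x ∈ 𝒵 i, x ∉ P) :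
    ∃ i, 0 < i ∧ ∃ x ∈ 𝒵 i, ∀ P ∈ T, x ∉ P := by
  classical
  induction T using Finset.induction_on with
  | empty =>
    obtain ⟨i, hi, x, hx⟩ := hne
    exact ⟨i, hi, x, hx, by simp⟩
  | insert P T _ ih =>
    obtain ⟨i, hi, z, hz, hzT⟩ := ih fun Q hQ => hT Q (Finset.mem_insert_of_mem hQ)
    obtain ⟨hP, j, hj, p, hp, hpP⟩ := hT P (Finset.mem_insert_self _ _)
    by_cases hzP : z ∈ P
    swap
    · refine ⟨i, hi, z, hz, fun Q hQ => ?_⟩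
      rcases Finset.mem_insert.1 hQ with rfl | hQ
      exacts [hzP, hzT Q hQ]
    -- Now `z ∈ P` avoids the other primes. Multiplying `p` by an element of each such `Q` outside
    -- `P` gives a `w` outside `P` but inside these `Q`.
    have hprod : ∀ U : Finset (Ideal A), (∀ Q ∈ U, ∃ k, 0 < k ∧ ∃ x ∈ 𝒵 k, x ∈ Q ∧ x ∉ P) →
        ∃ m, 0 < m ∧ ∃ x ∈ 𝒵 m, x ∉ P ∧ ∀ Q ∈ U, x ∈ Q := by
      intro U
      induction U using Finset.induction_on with
      | empty => exact fun _ => ⟨j, hj, p, hp, hpP, by simp⟩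
      | insert Q U _ ihU =>
        intro hU
        obtain ⟨m, hm, x, hx, hxP, hxU⟩ := ihU fun Q' hQ' => hU Q' (Finset.mem_insert_of_mem hQ')
        obtain ⟨k, hk, q, hq, hqQ, hqP⟩ := hU Q (Finset.mem_insert_self _ _)
        refine ⟨m + k, by omega, x * q, hmul _ _ _ hx _ hq, hP.mul_notMem hxP hqP, ?_⟩
        intro Q' hQ'
        rcases Finset.mem_insert.1 hQ' with rfl | hQ'
        exacts [Q'.mul_mem_left _ hqQ, Q'.mul_mem_right _ (hxU Q' hQ')]
    obtain ⟨m, hm, w, hw, hwP, hwT⟩ :=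
      hprod (T.filter fun Q => ∃ k, 0 < k ∧ ∃ x ∈ 𝒵 k, x ∈ Q ∧ x ∉ P)
        fun Q hQ => (Finset.mem_filter.1 hQ).2
    obtain ⟨m, rfl⟩ : ∃ m', m = m' + 1 := ⟨m - 1, by omega⟩
    obtain ⟨i, rfl⟩ : ∃ i', i = i' + 1 := ⟨i - 1, by omega⟩
    -- The exponents equalize the degrees `i + 1` of `z` and `m + 1` of `w`.
    have hsum : z ^ (m + 1) + w ^ (i + 1) ∈ 𝒵 ((m + 1) * (i + 1)) := by
      refine hadd _ _ (pow_mem_of_mul_mem hmul hz m) _ ?_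
      rw [mul_comm]
      exact pow_mem_of_mul_mem hmul hw i
    have hnotP : z ^ (m + 1) + w ^ (i + 1) ∉ P := fun h =>
      hwP (hP.mem_of_pow_mem _ ((P.add_mem_iff_right (P.pow_mem_of_mem hzP _ (by omega))).1 h))
    refine ⟨_, by positivity, _, hsum, fun Q hQ => ?_⟩
    rcases Finset.mem_insert.1 hQ with rfl | hQ
    · exact hnotP
    have hQp := (hT Q (Finset.mem_insert_of_mem hQ)).1
    by_cases hQT : ∃ k, 0 < k ∧ ∃ x ∈ 𝒵 k, x ∈ Q ∧ x ∉ P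
    · have hwQ := hwT Q (Finset.mem_filter.2 ⟨hQ, hQT⟩)
      exact fun h => hzT Q hQ
        (hQp.mem_of_pow_mem _ ((Q.add_mem_iff_left (Q.pow_mem_of_mem hwQ _ (by omega))).1 h))
    -- The homogeneous elements of positive degree in this `Q` all lie in `P`, so avoiding `P` is
    -- enough.
    · exact fun h => hQT ⟨_, by positivity, _, hsum, h, hnotP⟩

/-- A finitely generated module without non-zero elements killed by all homogeneous elements of
positive degree admits a regular homogeneous element of positive degree. -/
theorem exists_homogeneous_regular [IsNoetherianRing A]
    (hadd : ∀ i, ∀ x ∈ 𝒵 i, ∀ y ∈ 𝒵 i, x + y ∈ 𝒵 i)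
    (hmul : ∀ i j, ∀ x ∈ 𝒵 i, ∀ y ∈ 𝒵 j, x * y ∈ 𝒵 (i + j)) (hne : ∃ i, 0 < i ∧ (𝒵 i).Nonempty)
    {N : Type*} [AddCommGroup N] [Module A N] [Module.Finite A N]
    (hN : ∀ n : N, (∀ i, 0 < i → ∀ x ∈ 𝒵 i, x • n = 0) → n = 0) :
    ∃ i, 0 < i ∧ ∃ x ∈ 𝒵 i, ∀ n : N, x • n = 0 → n = 0 := by
  -- The zero divisors are the union of the finitely many associated primes. Each is the annihilator
  -- of some `n ≠ 0`, so by `hN` it misses a homogeneous element of positive degree.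
  obtain ⟨i, hi, x, hx, hxP⟩ := exists_homogeneous_notMem hadd hmul hne
    (associatedPrimes.finite A N).toFinset fun P hP => by
      rw [Set.Finite.mem_toFinset, AssociatedPrimes.mem_iff, isAssociatedPrime_iff] at hP
      obtain ⟨hP, n, rfl⟩ := hP
      refine ⟨hP, ?_⟩
      by_contra! h
      have hn : n = 0 := hN n fun i hi x hx => by
        simpa using h i hi x hx
      exact hP.ne_top (by simp [hn])
  refine ⟨i, hi, x, hx, fun n hn => ?_⟩
  by_contra hn0
  have : x ∈ ⋃ p ∈ associatedPrimes A N, (p : Set A) := by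
    rw [biUnion_associatedPrimes_eq_zero_divisors]
    exact ⟨n, hn0, hn⟩
  obtain ⟨P, hP, hxmem⟩ := Set.mem_iUnion₂.1 this
  exact hxP P (by simpa using hP) hxmem

end Avoidance

/-- The generators are taken from `G` itself so that they keep its properties, such as centrality
and homogeneity. -/
theorem exists_fin_generating_subset {R : Type*} [Ring R] [IsNoetherianRing R] (G : Set R) :
    ∃ (n : ℕ) (y : Fin n → R), (∀ j, y j ∈ G) ∧ G ⊆ Submodule.span R (Set.range y) := by
  obtain ⟨s, hs, hspan⟩ := (Submodule.fg_span_iff_fg_span_finset_subset (R := R) G).1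
    (IsNoetherian.noetherian _)
  refine ⟨s.card, fun j => s.equivFin.symm j, fun j => hs (s.equivFin.symm j).2, ?_⟩
  have : Set.range (fun j => (s.equivFin.symm j : R)) = s := by
    rw [Set.range_comp' Subtype.val s.equivFin.symm, s.equivFin.symm.range_eq_univ]
    simp
  rw [this, ← hspan]
  exact Submodule.subset_span

/-! ### Central projections of noetherian rings -/

section CentralProjection

variable {R : Type*} [Ring R]

/-- An additive projection of `R` onto a central subring `E` that is `E`-linear and whose kernel
is compatible with multiplication: the identity of a commutative ring, or the projection of a
graded-commutative ring onto its even part. -/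
structure IsCentralProjection (π : R →+ R) : Prop where
  map_one : π 1 = 1
  comm : ∀ a b, π a * b = b * π a
  map_mul : ∀ a b, π (a * π b) = π a * π b
  sub_map : ∀ a b, a * (b - π b) - π (a * (b - π b)) = π a * (b - π b)

namespace IsCentralProjection

variable {π : R →+ R} (h : IsCentralProjection π)

include h

theorem map_map (a : R) : π (π a) = π a := by
  simpa [h.map_one] using h.map_mul 1 a

/-- The range of a central projection, as a subring. -/
def range : Subring R where
  carrier := {a | π a = a}
  mul_mem' {a b} ha hb := by
    have := h.map_mul a b
    rwa [show π a = a from ha, show π b = b from hb] at this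
  one_mem' := h.map_one
  add_mem' {a b} ha hb := by
    rw [Set.mem_ofPred_eq, map_add, show π a = a from ha, show π b = b from hb]
  zero_mem' := map_zero π
  neg_mem' {a} ha := by rw [Set.mem_ofPred_eq, map_neg, show π a = a from ha]

theorem mem_range {a : R} : a ∈ h.range ↔ π a = a := Iff.rfl

theorem map_mem_range (a : R) : π a ∈ h.range := h.map_map a

theorem comm_of_mem {a : R} (ha : a ∈ h.range) (b : R) : a * b = b * a := by
  rw [← h.mem_range.1 ha, h.comm]

/-- The range of a central projection is commutative. -/
abbrev rangeCommRing : CommRing h.range where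
  mul_comm a b := Subtype.ext (h.comm_of_mem a.2 b)

/-- Extension of ideals to left ideals `R I` is strictly monotone, because `π` maps `R I` back into
`I`; so ascending chains stabilize. -/
theorem isNoetherianRing_range [IsNoetherianRing R] : IsNoetherianRing h.range := by
  let f : Ideal h.range → Ideal R := fun I => Ideal.span (Subtype.val '' (I : Set h.range))
  have hf : ∀ I : Ideal h.range, ∀ x ∈ f I, ∀ a, ∃ i ∈ I, (i : R) = π (a * x) := by
    intro I x hx
    refine Submodule.span_induction ?_ ?_ ?_ ?_ hx
    · rintro _ ⟨i, hi, rfl⟩ a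
      refine ⟨⟨π a, h.map_mem_range a⟩ * i, I.mul_mem_left _ hi, ?_⟩
      have := h.map_mul a i
      rw [h.mem_range.1 i.2] at this
      exact this.symm
    · intro a
      exact ⟨0, I.zero_mem, by simp⟩
    · intro x y _ _ hx hy a
      obtain ⟨i, hi, hi'⟩ := hx a
      obtain ⟨j, hj, hj'⟩ := hy a
      exact ⟨i + j, I.add_mem hi hj, by rw [mul_add, map_add, ← hi', ← hj']; rfl⟩
    · intro b x _ hx a
      rw [smul_eq_mul, ← mul_assoc]
      exact hx (a * b)
  have hle : ∀ I J, f I ≤ f J → I ≤ J := by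
    intro I J hIJ e he
    obtain ⟨j, hj, hje⟩ := hf J e (hIJ (Ideal.subset_span ⟨e, he, rfl⟩)) 1
    rw [one_mul, h.mem_range.1 e.2] at hje
    rwa [← Subtype.ext hje]
  have hmono : StrictMono f :=
    Monotone.strictMono_of_injective
      (fun I J hIJ => Ideal.span_mono (Set.image_mono hIJ))
      fun I J hIJ => le_antisymm (hle I J hIJ.le) (hle J I hIJ.ge)
  rw [isNoetherianRing_iff, isNoetherian_iff']
  exact hmono.wellFoundedGT

/-- Finitely many elements `b - π b` generate the left ideal of all of them. By `sub_map`, applying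
`1 - π` to a left combination replaces its coefficients by their images under `π`, so these elements
together with `1` generate `R` over the range. -/
theorem finite_range [IsNoetherianRing R] : Module.Finite h.range R := by
  obtain ⟨s, hs, hspan⟩ := (Submodule.fg_span_iff_fg_span_finset_subset (R := R)
    {x | ∃ b, x = b - π b}).1 (IsNoetherian.noetherian _)
  have key : ∀ x ∈ Submodule.span R (s : Set R), ∀ a,
      a * x - π (a * x) ∈ Submodule.span h.range (s : Set R) := by
    intro x hx
    refine Submodule.span_induction ?_ ?_ ?_ ?_ hx
    · intro x hx a
      obtain ⟨b, rfl⟩ := hs hx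
      rw [h.sub_map]
      exact Submodule.smul_mem _ (⟨π a, h.map_mem_range a⟩ : h.range) (Submodule.subset_span hx)
    · intro a
      simp
    · intro x y _ _ hx hy a
      rw [mul_add, map_add, add_sub_add_comm]
      exact add_mem (hx a) (hy a)
    · intro b x _ hx a
      rw [smul_eq_mul, ← mul_assoc]
      exact hx (a * b)
  refine ⟨Submodule.fg_def.2 ⟨insert 1 (s : Set R), s.finite_toSet.insert 1, ?_⟩⟩
  rw [eq_top_iff]
  intro a _
  have h1 : a - π a ∈ Submodule.span h.range (s : Set R) := by
    have h2 : a - π a ∈ Submodule.span R (s : Set R) := by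
      rw [← hspan]
      exact Submodule.subset_span ⟨a, rfl⟩
    simpa [h.map_map] using key _ h2 1
  have h3 : π a ∈ Submodule.span h.range (insert 1 (s : Set R)) := by
    have := Submodule.smul_mem _ (⟨π a, h.map_mem_range a⟩ : h.range)
      (Submodule.subset_span (Set.mem_insert (1 : R) (s : Set R)))
    simpa [Subring.smul_def] using this
  rw [← sub_add_cancel a (π a)]
  exact add_mem (Submodule.span_mono (Set.subset_insert _ _) h1) h3

/-- The homogeneous elements of positive degree in the range of a central projection contain a
regular element for a finitely generated module, unless they all kill some non-zero element. -/
theorem exists_regular [IsNoetherianRing R] {σ : Type*} [SetLike σ R] [AddSubmonoidClass σ R]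
    (𝒜 : ℕ → σ) [SetLike.GradedMonoid 𝒜] (N : Type*) [AddCommGroup N] [Module R N]
    [Module.Finite R N]
    (hN : ∀ n : N, (∀ x, (π x = x ∧ ∃ i, 0 < i ∧ x ∈ 𝒜 i) → x • n = 0) → n = 0) :
    ∃ x, (π x = x ∧ ∃ i, 0 < i ∧ x ∈ 𝒜 i) ∧ ∀ n : N, x • n = 0 → n = 0 := by
  let _ := h.rangeCommRing
  have := h.isNoetherianRing_range
  have := h.finite_range
  have : Module.Finite h.range N := Module.Finite.trans R N
  obtain ⟨i, hi, x, hx, hreg⟩ := exists_homogeneous_regular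
    (𝒵 := fun i => {z : h.range | (z : R) ∈ 𝒜 i}) (N := N)
    (fun i x hx y hy => add_mem (S := σ) hx hy) (fun i j x hx y hy => SetLike.mul_mem_graded hx hy)
    ⟨1, one_pos, 0, zero_mem (𝒜 1)⟩ fun n hn => hN n fun x ⟨hx, i, hi, hxi⟩ =>
      hn i hi ⟨x, hx⟩ hxi
  exact ⟨x, ⟨x.2, i, hi, hx⟩, hreg⟩

end IsCentralProjection

end CentralProjection

/-! ### The even part of a graded-commutative algebra -/

section EvenPart

variable {F : Type x} [Field F] {R : Type u} [Ring R] [Algebra F R] (𝒜 : ℕ → Submodule F R)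
  [GradedAlgebra 𝒜]

/-- The projection of a graded algebra onto the sum of the components of even degree. -/
noncomputable def evenPart : R →+ R :=
  ((DirectSum.toModule F ℕ R fun i => if Even i then (𝒜 i).subtype else 0) ∘ₗ
    (DirectSum.decomposeLinearEquiv 𝒜).toLinearMap).toAddMonoidHom

variable {𝒜}

theorem evenPart_of_mem {i : ℕ} {a : R} (ha : a ∈ 𝒜 i) :
    evenPart 𝒜 a = if Even i then a else 0 := by
  have : evenPart 𝒜 a = DirectSum.toModule F ℕ R
    (fun i => if Even i then (𝒜 i).subtype else 0) (DirectSum.decompose 𝒜 a) := rfl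
  rw [this, DirectSum.decompose_of_mem 𝒜 ha]
  erw [DirectSum.toModule_lof]
  split_ifs <;> rfl

/-- Two additive maps on a graded algebra agree if they agree on homogeneous elements. -/
theorem addMonoidHom_ext_homogeneous {N : Type*} [AddCommGroup N] {f g : R →+ N}
    (hfg : ∀ i, ∀ a ∈ 𝒜 i, f a = g a) : f = g := by
  ext a
  induction a using DirectSum.Decomposition.inductionOn 𝒜 with
  | zero => simp
  | homogeneous a => exact hfg _ a a.2
  | add a b ha hb => simp [ha, hb]

/-- Everything is additive, so homogeneous elements suffice: an even degree makes the sign trivial,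
and parities add under multiplication. -/
theorem isCentralProjection_evenPart
    (hc : ∀ (i j : ℕ) (a b : R), a ∈ 𝒜 i → b ∈ 𝒜 j → a * b = (-1) ^ (i * j) * (b * a)) :
    IsCentralProjection (evenPart 𝒜) where
  map_one := by
    rw [evenPart_of_mem (𝒜 := 𝒜) SetLike.GradedOne.one_mem]
    simp
  comm a b := by
    have : AddMonoidHom.mul.comp (evenPart 𝒜) = AddMonoidHom.mul.flip.comp (evenPart 𝒜) := by
      refine addMonoidHom_ext_homogeneous (𝒜 := 𝒜) fun i a ha => ?_
      refine addMonoidHom_ext_homogeneous (𝒜 := 𝒜) fun j b hb => ?_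
      have he := evenPart_of_mem ha
      by_cases hi : Even i
      · rw [if_pos hi] at he
        simpa [he, (hi.mul_right j).neg_one_pow] using hc i j a b ha hb
      · simp [he, hi]
    exact DFunLike.congr_fun (DFunLike.congr_fun this a) b
  map_mul a b := by
    have : (AddMonoidHom.mul.flip.comp (evenPart 𝒜)).compr₂ (evenPart 𝒜) =
        (AddMonoidHom.mul.compl₂ (evenPart 𝒜)|>.comp (evenPart 𝒜)).flip := by
      refine addMonoidHom_ext_homogeneous (𝒜 := 𝒜) fun j b hb => ?_
      refine addMonoidHom_ext_homogeneous (𝒜 := 𝒜) fun i a ha => ?_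
      have hea := evenPart_of_mem ha
      have heb := evenPart_of_mem hb
      have heab := evenPart_of_mem (SetLike.mul_mem_graded ha hb)
      by_cases hj : Even j <;> by_cases hi : Even i <;>
        simp [hea, heb, hi, hj, heab, Nat.even_add]
    exact DFunLike.congr_fun (DFunLike.congr_fun this b) a
  sub_map a b := by
    induction a using DirectSum.Decomposition.inductionOn 𝒜 with
    | zero => simp
    | add a a' ha ha' => rw [add_mul, map_add, map_add, add_mul, add_sub_add_comm, ha, ha']
    | @homogeneous i a =>
      induction b using DirectSum.Decomposition.inductionOn 𝒜 with
      | zero => simp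
      | add b b' hb hb' =>
        rw [map_add, add_sub_add_comm, mul_add, map_add, mul_add, add_sub_add_comm, hb, hb']
      | @homogeneous j b =>
        have hea := evenPart_of_mem a.2
        have heb := evenPart_of_mem b.2
        have heab := evenPart_of_mem (SetLike.mul_mem_graded a.2 b.2)
        by_cases hj : Even j <;> by_cases hi : Even i <;>
          simp [hea, heb, hi, hj, heab, Nat.even_add]

/-- The identity serves for commutative `R`, which includes characteristic 2, where signs disappear.
Otherwise the even part serves, and an odd `x` satisfies `2 x² = 0`. -/
theorem IsCommOrGradedComm.exists_isCentralProjection (h : IsCommOrGradedComm 𝒜) :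
    ∃ π : R →+ R, IsCentralProjection π ∧ ∀ i, ∀ x ∈ 𝒜 i, π x = x ∨ x * x = 0 := by
  have hid : (∀ a b : R, a * b = b * a) → ∃ π : R →+ R, IsCentralProjection π ∧
      ∀ i, ∀ x ∈ 𝒜 i, π x = x ∨ x * x = 0 := fun hc =>
    ⟨AddMonoidHom.id R, ⟨rfl, hc, fun _ _ => rfl, fun a b => by simp⟩, fun _ _ _ => Or.inl rfl⟩
  rcases h with hc | hc
  · exact hid hc
  by_cases h2 : (2 : F) = 0
  · refine hid fun a b => ?_
    have hneg : (-1 : R) = 1 := by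
      have : (algebraMap F R) 2 = 0 := by rw [h2, map_zero]
      rw [map_ofNat, ← one_add_one_eq_two] at this
      exact (eq_neg_of_add_eq_zero_left this).symm
    have : (AddMonoidHom.mul : R →+ R →+ R) = AddMonoidHom.mul.flip := by
      refine addMonoidHom_ext_homogeneous (𝒜 := 𝒜) fun i a ha => ?_
      refine addMonoidHom_ext_homogeneous (𝒜 := 𝒜) fun j b hb => ?_
      simpa [hneg] using hc i j a b ha hb
    exact DFunLike.congr_fun (DFunLike.congr_fun this a) b
  · refine ⟨evenPart 𝒜, isCentralProjection_evenPart hc, fun i x hx => ?_⟩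
    rw [evenPart_of_mem hx]
    split_ifs with hi
    · exact Or.inl rfl
    · right
      have := hc i i x x hx hx
      rw [(Nat.not_even_iff_odd.1 hi |>.mul (Nat.not_even_iff_odd.1 hi)).neg_one_pow, neg_one_mul,
        eq_neg_iff_add_eq_zero, ← two_smul F] at this
      exact (smul_eq_zero_iff_right h2).1 this

end EvenPart

/-! ### Graded products -/

section Truncation

variable {N : Type*} [AddCommGroup N] {𝒩 : ℕ → AddSubgroup N}

/-- The sum of the homogeneous components of degree less than `D`. -/
noncomputable def truncation (h : DirectSum.IsInternal 𝒩) (D : ℕ) : N →+ N :=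
  (DirectSum.toAddMonoid fun d => if d < D then (𝒩 d).subtype else 0).comp
    (AddEquiv.ofBijective (DirectSum.coeAddMonoidHom 𝒩) h).symm.toAddMonoidHom

theorem truncation_of_mem (h : DirectSum.IsInternal 𝒩) (D : ℕ) {d : ℕ} {n : N} (hn : n ∈ 𝒩 d) :
    truncation h D n = if d < D then n else 0 := by
  have : (AddEquiv.ofBijective (DirectSum.coeAddMonoidHom 𝒩) h).symm n =
      DirectSum.of (fun d => 𝒩 d) d ⟨n, hn⟩ := by
    rw [AddEquiv.symm_apply_eq]
    exact (DirectSum.coeAddMonoidHom_of 𝒩 d ⟨n, hn⟩).symm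
  change DirectSum.toAddMonoid _ ((AddEquiv.ofBijective _ h).symm n) = _
  rw [this, DirectSum.toAddMonoid_of]
  split_ifs <;> rfl

@[elab_as_elim]
theorem DirectSum.IsInternal.induction_homogeneous (h : DirectSum.IsInternal 𝒩) {p : N → Prop}
    (hp : ∀ d, ∀ n ∈ 𝒩 d, p n) (hadd : ∀ n n', p n → p n' → p (n + n')) (n : N) : p n := by
  obtain ⟨s, rfl⟩ := h.surjective n
  induction s using DirectSum.induction_on with
  | zero => exact hp 0 _ (by simp)
  | of d n => exact hp d _ (by simp)
  | add s t hs ht => rw [map_add]; exact hadd _ _ hs ht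

theorem truncation_truncation (h : DirectSum.IsInternal 𝒩) {D D' : ℕ} (hD : D ≤ D') (n : N) :
    truncation h D' (truncation h D n) = truncation h D n := by
  refine h.induction_homogeneous (fun d n hn => ?_) (fun n n' hn hn' => ?_) n
  · rw [truncation_of_mem h D hn]
    split_ifs with hd
    · rw [truncation_of_mem h D' hn, if_pos (hd.trans_le hD)]
    · exact map_zero _
  · rw [map_add, map_add, hn, hn']

theorem truncation_eq_self_of_le (h : DirectSum.IsInternal 𝒩) {D D' : ℕ} (hD : D ≤ D') {n : N}
    (hn : truncation h D n = n) : truncation h D' n = n := by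
  rw [← hn, truncation_truncation h hD]

theorem truncation_zero (h : DirectSum.IsInternal 𝒩) (n : N) : truncation h 0 n = 0 := by
  refine h.induction_homogeneous (fun d n hn => ?_) (fun n n' hn hn' => ?_) n
  · simp [truncation_of_mem h 0 hn]
  · rw [map_add, hn, hn', add_zero]

theorem truncation_succ_sub_mem (h : DirectSum.IsInternal 𝒩) (D : ℕ) (n : N) :
    truncation h (D + 1) n - truncation h D n ∈ 𝒩 D := by
  refine h.induction_homogeneous (fun d n hn => ?_) (fun n n' hn hn' => ?_) n
  · rw [truncation_of_mem h _ hn, truncation_of_mem h _ hn]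
    rcases lt_trichotomy d D with hd | rfl | hd
    · simp [hd, hd.trans (Nat.lt_succ_self D)]
    · simpa using hn
    · rw [if_neg (by omega), if_neg (by omega), sub_zero]
      exact zero_mem _
  · rw [map_add, map_add, add_sub_add_comm]
    exact add_mem hn hn'

variable {F : Type*} [Field F] {R : Type*} [Ring R] [Algebra F R] {𝒜 : ℕ → Submodule F R}
  [Module R N]

/-- A homogeneous scalar shifts the cut-off by exactly its degree, so Koszul equations survive a
truncation with matching cut-offs. -/
theorem IsModuleGrading.truncation_smul (h : IsModuleGrading 𝒜 𝒩) {i : ℕ} {a : R} (ha : a ∈ 𝒜 i)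
    (D : ℕ) (n : N) :
    truncation h.isInternal (D + i) (a • n) = a • truncation h.isInternal D n := by
  refine h.isInternal.induction_homogeneous (fun d n hn => ?_) (fun n n' hn hn' => ?_) n
  · rw [truncation_of_mem _ _ hn, truncation_of_mem _ _ (h.smul_mem i d a n ha hn)]
    by_cases hd : d < D
    · rw [if_pos hd, if_pos (by omega)]
    · rw [if_neg hd, if_neg (by omega), smul_zero]
  · rw [smul_add, map_add, map_add, smul_add, hn, hn']

end Truncation

section GradedProduct

variable {F : Type x} [Field F] {R : Type u} [Ring R] [Algebra F R] {𝒜 : ℕ → Submodule F R}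
  {C : Type w} [Category.{w'} C] {Φ : C ⥤ ModuleCat.{v} R} {𝒢 : ∀ c, ℕ → AddSubgroup (Φ.obj c)}

/-- The graded product consists of the families whose components have bounded degrees. -/
theorem mem_gradedProduct_iff [GradedAlgebra 𝒜] (h𝒢 : ∀ c, IsModuleGrading 𝒜 (𝒢 c)) {κ : Type*}
    (f : κ → C) (z : ∀ k, Φ.obj (f k)) :
    z ∈ gradedProduct 𝒢 f ↔ ∃ D, ∀ k, truncation (h𝒢 (f k)).isInternal D (z k) = z k := by
  constructor
  · intro hz
    refine Submodule.span_induction ?_ ?_ ?_ ?_ hz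
    · rintro z ⟨d, hd⟩
      exact ⟨d + 1, fun k => by rw [truncation_of_mem _ _ (hd k), if_pos (Nat.lt_succ_self d)]⟩
    · exact ⟨0, fun k => map_zero _⟩
    · rintro z z' - - ⟨D, hD⟩ ⟨D', hD'⟩
      refine ⟨max D D', fun k => ?_⟩
      rw [Pi.add_apply, map_add, truncation_eq_self_of_le _ (le_max_left D D') (hD k),
        truncation_eq_self_of_le _ (le_max_right D D') (hD' k)]
    · rintro a z - ⟨D, hD⟩
      induction a using DirectSum.Decomposition.inductionOn 𝒜 with
      | zero => exact ⟨0, fun k => by simp⟩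
      | @homogeneous i a =>
        exact ⟨D + i, fun k => by rw [Pi.smul_apply, (h𝒢 (f k)).truncation_smul a.2, hD k]⟩
      | add a a' ha ha' =>
        obtain ⟨E, hE⟩ := ha
        obtain ⟨E', hE'⟩ := ha'
        refine ⟨max E E', fun k => ?_⟩
        rw [add_smul, Pi.add_apply, map_add,
          truncation_eq_self_of_le _ (le_max_left E E') (hE k),
          truncation_eq_self_of_le _ (le_max_right E E') (hE' k)]
  · rintro ⟨D, hD⟩
    -- Telescoping: the `d`-th summand is the family of components of degree `d`.
    have : z = ∑ d ∈ Finset.range D, fun k => truncation (h𝒢 (f k)).isInternal (d + 1) (z k) -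
        truncation (h𝒢 (f k)).isInternal d (z k) := by
      funext k
      rw [Finset.sum_apply, Finset.sum_range_sub
        (fun d => truncation (h𝒢 (f k)).isInternal d (z k)), truncation_zero, sub_zero, hD]
    rw [this]
    exact sum_mem fun d _ => Submodule.subset_span ⟨d, fun k => truncation_succ_sub_mem _ _ _⟩

/-- Vanishing of the Koszul cohomology of homogeneous elements passes to graded products. -/
theorem koszulExactAt_gradedProduct [GradedAlgebra 𝒜] (h𝒢 : ∀ c, IsModuleGrading 𝒜 (𝒢 c))
    {κ : Type*} (f : κ → C) {ι : Type*} [LinearOrder ι] [Fintype ι] {y : ι → R} {deg : ι → ℕ}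
    (hdeg : ∀ j, y j ∈ 𝒜 (deg j)) {i : ℕ} (h : ∀ c, KoszulExactAt y (Φ.obj c) i) :
    KoszulExactAt y (gradedProduct 𝒢 f) i := by
  intro u hu hd
  have hsub : ∀ u : Finset ι → gradedProduct 𝒢 f, ∀ T k,
      (koszulD y u T).1 k = koszulD y (fun T => (u T).1 k) T := by
    intro u T k
    have := congrFun (koszulD_comp y (LinearMap.proj (R := R) (φ := fun k => Φ.obj (f k)) k ∘ₗ
      (gradedProduct 𝒢 f).subtype) u) T
    exact this.symm
  choose v hv hdv using fun k => h (f k) (fun T => (u T).1 k)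
    (fun T hT => by rw [hu T hT]; rfl) (funext fun T => by rw [← hsub, hd]; rfl)
  choose E hE using fun T => (mem_gradedProduct_iff h𝒢 f _).1 (u T).2
  set D := Finset.univ.sup E
  have hD : ∀ T k, ∀ D' ≥ D, truncation (h𝒢 (f k)).isInternal D' ((u T).1 k) =
      (u T).1 k := fun T k D' hD' =>
    truncation_eq_self_of_le _ ((Finset.le_sup (Finset.mem_univ T)).trans hD') (hE T k)
  -- The componentwise solutions may have unbounded degrees. The cut-off at `T` exceeds that at
  -- `T.erase j` by `deg j`, so truncation commutes with the differential, and it leaves `u`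
  -- unchanged since each cut-off is at least `D`.
  refine ⟨fun T => ⟨fun k => truncation (h𝒢 (f k)).isInternal (D + ∑ j ∈ T, deg j) (v k T),
    (mem_gradedProduct_iff h𝒢 f _).2 ⟨_, fun k => truncation_truncation _ le_rfl _⟩⟩, ?_, ?_⟩
  · intro T hT
    refine Subtype.ext (funext fun k => ?_)
    simp [hv k T hT]
  · funext T
    refine Subtype.ext (funext fun k => ?_)
    rw [hsub, ← hD T k (D + ∑ j ∈ T, deg j) (Nat.le_add_right _ _), ← congrFun (hdv k) T,
      koszulD_apply, koszulD_apply, Finset.sum_apply, Finset.sum_apply, map_sum]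
    refine Finset.sum_congr rfl fun j _ => ?_
    by_cases hj : j ∈ T
    · have hsum : D + ∑ l ∈ T, deg l = D + ∑ l ∈ T.erase j, deg l + deg j := by
        rw [add_assoc, Finset.sum_erase_add T deg hj]
      rw [Pi.smul_apply, Pi.smul_apply, hsum, (h𝒢 (f k)).truncation_smul (hdeg j)]
      simp [wedge, hj]
    · simp [wedge, hj]

theorem map_coboundary_gradedProduct_le
    (hΦ : ∀ (c d : C) (f : c ⟶ d) (i : ℕ), ∀ z ∈ 𝒢 c i, Φ.map f z ∈ 𝒢 d i) (n : ℕ) :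
    (gradedProduct 𝒢 fun σ : ComposableArrows C n => σ.obj (Fin.last n)).map (coboundary Φ n) ≤
      gradedProduct 𝒢 fun σ : ComposableArrows C (n + 1) => σ.obj (Fin.last (n + 1)) := by
  rw [gradedProduct, Submodule.map_span_le]
  rintro z ⟨d, hd⟩
  refine Submodule.subset_span ⟨d, fun σ => ?_⟩
  rw [coboundary_apply]
  exact sum_mem fun k _ => zsmul_mem (hΦ _ _ _ _ _ (hd _)) _

theorem map_gradedProduct_familyEquiv :
    (gradedProduct 𝒢 id).map (familyEquiv Φ).toLinearMap =
      gradedProduct 𝒢 fun σ : ComposableArrows C 0 => σ.obj (Fin.last 0) := by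
  rw [gradedProduct, gradedProduct, Submodule.map_span]
  congr 1
  ext z
  constructor
  · rintro ⟨z, ⟨d, hd⟩, rfl⟩
    exact ⟨d, fun σ => hd _⟩
  · rintro ⟨d, hd⟩
    exact ⟨(familyEquiv Φ).symm z, ⟨d, fun c => hd (ComposableArrows.mk₀ c)⟩,
      (familyEquiv Φ).apply_symm_apply z⟩

theorem range_toProduct_le_gradedProduct {M : ModuleCat.{v} R} {ℳ : ℕ → AddSubgroup M}
    (hℳ : DirectSum.IsInternal ℳ) (τ : (Functor.const C).obj M ⟶ Φ)
    (hτ : ∀ (c : C) (i : ℕ), ∀ z ∈ ℳ i, (τ.app c).hom z ∈ 𝒢 c i) :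
    LinearMap.range (toProduct τ) ≤ gradedProduct 𝒢 id := by
  rintro _ ⟨m, rfl⟩
  refine hℳ.induction_homogeneous (fun d m hm => ?_) (fun m m' hm hm' => ?_) m
  · exact Submodule.subset_span ⟨d, fun c => hτ c d m hm⟩
  · rw [map_add]
    exact add_mem hm hm'

end GradedProduct

/-! ### Depth and the modules `Lⁱ` -/

section DepthLimitDefect

variable {R : Type u} [Ring R] [IsNoetherianRing R] {C : Type w} [Category.{w'} C]
  {Φ : C ⥤ ModuleCat.{v} R} [∀ c, Module.Finite R (Φ.obj c)] {M : ModuleCat.{v} R}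
  [Module.Finite R M]

/-- If the depth of finitely generated modules is detected by the Koszul cohomology of central
elements `y j`, then the depth of `M` is controlled by the vanishing of the modules `Lⁱ`. -/
theorem le_depthIn_iff_limitDefect {S : Set R} {ι : Type*} [LinearOrder ι] [Fintype ι] {y : ι → R}
    (hy : ∀ j a, y j * a = a * y j)
    (hv : ∀ (r : ℕ) (N : Type v) [AddCommGroup N] [Module R N] [Module.Finite R N],
      (r : ℕ∞) ≤ depthIn S N ↔ ∀ i < r, KoszulExactAt y N i)
    (hw : ∀ (r : ℕ) (N : Type max v w w') [AddCommGroup N] [Module R N] [Module.Finite R N],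
      (r : ℕ∞) ≤ depthIn S N ↔ ∀ i < r, KoszulExactAt y N i)
    (τ : (Functor.const C).obj M ⟶ Φ) (P₀ : Submodule R (∀ c, Φ.obj c))
    (P : ∀ n, Submodule R (Cochain Φ n)) (hτ : LinearMap.range (toProduct τ) ≤ P₀)
    (hP₀ : P₀.map (familyEquiv Φ).toLinearMap = P 0)
    (hδ : ∀ n, (P n).map (coboundary Φ n) ≤ P (n + 1))
    (hP : ∀ i, (∀ c, KoszulExactAt y (Φ.obj c) i) → ∀ n, KoszulExactAt y (P n) i)
    (hfin : (Finite C ∧ ∀ c d : C, Finite (c ⟶ d)) ∨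
      ∀ i : ℤ, -1 ≤ i → Module.Finite R (limitDefect τ P₀ P i))
    (r : ℕ) (hΦ : ∀ c, (r : ℕ∞) ≤ depthIn S (Φ.obj c))
    (hL : ∀ i : ℤ, -1 ≤ i →
      Subsingleton (limitDefect τ P₀ P i) ∨ depthIn S (limitDefect τ P₀ P i) = 0) :
    (r : ℕ∞) ≤ depthIn S M ↔
      ∀ i : ℤ, -1 ≤ i → i ≤ (r : ℤ) - 2 → Subsingleton (limitDefect τ P₀ P i) := by
  rw [hv]
  refine koszulExactAt_iff_limitDefect hy τ P₀ P hτ hP₀ hδ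
    (fun n i hi => hP i (fun c => (hv r _).1 (hΦ c) i hi) n) fun i hi h0 => ?_
  have : Module.Finite R (limitDefect τ P₀ P i) := by
    rcases hfin with ⟨_, _⟩ | hfin
    · exact finite_limitDefect τ P₀ P i
    · exact hfin i hi
  refine (hL i hi).resolve_right fun hdepth => ?_
  -- For a finitely generated `Lⁱ`, vanishing `H⁰` means depth at least 1.
  have := (hw 1 (limitDefect τ P₀ P i)).2 fun k hk => by rwa [Nat.lt_one_iff.1 hk]
  simp [hdepth] at this

end DepthLimitDefect

/-! ### Koszul detection of depth in the two settings, and the theorem. -/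

theorem le_localDepth_iff_koszulExactAt {R : Type u} [CommRing R] [IsLocalRing R]
    [IsNoetherianRing R] {ι : Type*} [LinearOrder ι] [Fintype ι] {y : ι → R}
    (hyG : ∀ j, y j ∈ (IsLocalRing.maximalIdeal R : Set R))
    (hspan : (IsLocalRing.maximalIdeal R : Set R) ⊆ Submodule.span R (Set.range y))
    (r : ℕ) (N : Type v) [AddCommGroup N] [Module R N] [Module.Finite R N] :
    (r : ℕ∞) ≤ localDepth R N ↔ ∀ i < r, KoszulExactAt y N i := by
  refine le_depthIn_iff_koszulExactAt hyG hspan subset_rfl (fun x _ a => mul_comm x a)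
    (fun N _ _ _ x hx _ => hx) (fun N _ _ _ hN => ?_) r N
  -- With the maximal ideal in every degree, homogeneous avoidance becomes ordinary prime avoidance.
  obtain ⟨-, -, x, hx, hreg⟩ := exists_homogeneous_regular (N := N)
    (𝒵 := fun _ => (IsLocalRing.maximalIdeal R : Set R))
    (fun _ x hx y hy => Ideal.add_mem _ hx hy) (fun _ _ x _ y hy => Ideal.mul_mem_left _ x hy)
    ⟨1, one_pos, 0, Ideal.zero_mem _⟩ fun n hn => hN n fun x hx => hn 1 one_pos x hx
  exact ⟨x, hx, hreg⟩

theorem le_gradedDepth_iff_koszulExactAt {F : Type x} [Field F] {R : Type u} [Ring R] [Algebra F R]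
    [IsNoetherianRing R] {𝒜 : ℕ → Submodule F R} [GradedAlgebra 𝒜] {π : R →+ R}
    (hπ : IsCentralProjection π) (hsq : ∀ i, ∀ x ∈ 𝒜 i, π x = x ∨ x * x = 0)
    {ι : Type*} [LinearOrder ι] [Fintype ι] {y : ι → R}
    (hyG : ∀ j, y j ∈ {x | π x = x ∧ ∃ i, 0 < i ∧ x ∈ 𝒜 i})
    (hspan : {x | π x = x ∧ ∃ i, 0 < i ∧ x ∈ 𝒜 i} ⊆ (Submodule.span R (Set.range y) : Set R))
    (r : ℕ) (N : Type v) [AddCommGroup N] [Module R N] [Module.Finite R N] :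
    (r : ℕ∞) ≤ gradedDepth 𝒜 N ↔ ∀ i < r, KoszulExactAt y N i := by
  refine le_depthIn_iff_koszulExactAt hyG hspan (fun x hx => hx.2)
    (fun x hx a => hπ.comm_of_mem hx.1 a) (fun N _ _ _ x hx hreg => ⟨?_, hx⟩)
    (fun N _ _ _ hN => hπ.exists_regular 𝒜 N hN) r N
  obtain ⟨i, -, hxi⟩ := hx
  refine (hsq i x hxi).resolve_right fun h => ?_
  obtain ⟨n, hn⟩ := exists_ne (0 : N)
  -- If `x² = 0`, regularity used twice gives `n = 0`.
  exact hn (hreg n (hreg _ (by rw [smul_smul, h, zero_smul])))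

theorem lemma1p1 :
    -- commutative noetherian local rings
    (∀ (R : Type u) [CommRing R] [IsLocalRing R] [IsNoetherianRing R]
      (C : Type w) [Category.{w'} C] (Φ : C ⥤ ModuleCat.{v} R)
      (_ : ∀ c, Module.Finite R (Φ.obj c))
      (M : ModuleCat.{v} R) (_ : Module.Finite R M) (τ : (Functor.const C).obj M ⟶ Φ)
      (_ : (Finite C ∧ ∀ c d : C, Finite (c ⟶ d)) ∨
        ∀ i : ℤ, -1 ≤ i → Module.Finite R (moduleL τ i))
      (r : ℕ) (_ : ∀ c, (r : ℕ∞) ≤ localDepth R (Φ.obj c))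
      (_ : ∀ i : ℤ, -1 ≤ i →
        Subsingleton (moduleL τ i) ∨ localDepth R (moduleL τ i) = 0),
      (r : ℕ∞) ≤ localDepth R M ↔
        ∀ i : ℤ, -1 ≤ i → i ≤ (r : ℤ) - 2 → Subsingleton (moduleL τ i)) ∧
    -- connected (graded-)commutative noetherian graded algebras over a field
    (∀ (F : Type x) [Field F] (R : Type u) [Ring R] [Nontrivial R] [Algebra F R]
      [IsNoetherianRing R] (𝒜 : ℕ → Submodule F R) [GradedAlgebra 𝒜]
      (_ : 𝒜 0 = 1) (_ : IsCommOrGradedComm 𝒜)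
      (C : Type w) [Category.{w'} C] (Φ : C ⥤ ModuleCat.{v} R)
      (_ : ∀ c, Module.Finite R (Φ.obj c))
      (𝒢 : ∀ c, ℕ → AddSubgroup (Φ.obj c)) (_ : ∀ c, IsModuleGrading 𝒜 (𝒢 c))
      (_ : ∀ (c d : C) (f : c ⟶ d) (i : ℕ), ∀ y ∈ 𝒢 c i, Φ.map f y ∈ 𝒢 d i)
      (M : ModuleCat.{v} R) (_ : Module.Finite R M)
      (ℳ : ℕ → AddSubgroup M) (_ : IsModuleGrading 𝒜 ℳ)
      (τ : (Functor.const C).obj M ⟶ Φ)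
      (_ : ∀ (c : C) (i : ℕ), ∀ y ∈ ℳ i, (τ.app c).hom y ∈ 𝒢 c i)
      (_ : (Finite C ∧ ∀ c d : C, Finite (c ⟶ d)) ∨
        ∀ i : ℤ, -1 ≤ i → Module.Finite R (gradedL τ 𝒢 i))
      (r : ℕ) (_ : ∀ c, (r : ℕ∞) ≤ gradedDepth 𝒜 (Φ.obj c))
      (_ : ∀ i : ℤ, -1 ≤ i →
        Subsingleton (gradedL τ 𝒢 i) ∨ gradedDepth 𝒜 (gradedL τ 𝒢 i) = 0),
      (r : ℕ∞) ≤ gradedDepth 𝒜 M ↔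
        ∀ i : ℤ, -1 ≤ i → i ≤ (r : ℤ) - 2 → Subsingleton (gradedL τ 𝒢 i)) := by
  refine ⟨?_, ?_⟩
  · intro R _ _ _ C _ Φ hΦfin M _ τ hfin r hΦ hL
    obtain ⟨n, y, hyG, hspan⟩ :=
      exists_fin_generating_subset (IsLocalRing.maximalIdeal R : Set R)
    exact le_depthIn_iff_limitDefect (fun j a => mul_comm _ _)
      (le_localDepth_iff_koszulExactAt hyG hspan) (le_localDepth_iff_koszulExactAt hyG hspan)
      τ ⊤ (fun _ => ⊤) le_top
      (by rw [Submodule.map_top, LinearMap.range_eq_top]; exact (familyEquiv Φ).surjective)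
      (fun _ => le_top)
      (fun i h n => .of_linearEquiv Submodule.topEquiv.symm (.pi fun σ => h _)) hfin r hΦ hL
  · intro F _ R _ _ _ _ 𝒜 _ _ hcomm C _ Φ hΦfin 𝒢 h𝒢 hΦ𝒢 M _ ℳ hℳ τ hτ hfin r hΦ hL
    obtain ⟨π, hπ, hsq⟩ := hcomm.exists_isCentralProjection
    obtain ⟨n, y, hyG, hspan⟩ :=
      exists_fin_generating_subset {x : R | π x = x ∧ ∃ i, 0 < i ∧ x ∈ 𝒜 i}
    -- These degrees fix the cut-offs in the graded products.
    choose deg _ hdeg using fun j => (hyG j).2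
    exact le_depthIn_iff_limitDefect (fun j => hπ.comm_of_mem (hyG j).1)
      (le_gradedDepth_iff_koszulExactAt hπ hsq hyG hspan)
      (le_gradedDepth_iff_koszulExactAt hπ hsq hyG hspan)
      τ _ _ (range_toProduct_le_gradedProduct hℳ.isInternal τ hτ) map_gradedProduct_familyEquiv
      (map_coboundary_gradedProduct_le hΦ𝒢)
      (fun i h n => koszulExactAt_gradedProduct h𝒢 _ hdeg h) hfin r hΦ hL
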